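/- **Theorem C2.43.** Let $G$ be a group (not necessarily finitely generated) and let $\chi\colon G\to\mathbb{R}$ be a non-zero character, i.e. a non-zero homomorphism into the additive group of $\mathbb{R}$. Then the following four statements are equivalent: 1. $[\chi]\in\Sigma^1(G)$; 2. for every generating system $\eta\colon\mathcal{X}\to G$ the measured tree $T(G,\mathcal{X},\chi)$ is a line; 3. every measured $G$-tree $(T,\le,\lambda)$ with associated character $\chi_T=\chi$ contains a $G$-invariant line; 4. every $(G,\mathbb{R})$-tree $(T,d)$ such that $G$ fixes an end $e$ of $(T,d)$ and the character associated to this end coincides with $\chi$ contains a $G$-invariant line. Here the terms have the following meaning. *Cayley graphs and $\Sigma^1$.* A generating system of $G$ is a map $\eta\colon\mathcal{X}\to G$ whose image generates $G$; the Cayley graph $\Gamma(G,\mathcal{X})$ has vertex set $G$ and edges joining $g$ to $g\,\eta(x)$ for $g\in G$, $x\in\mathcal{X}$. For $r\in\mathbb{R}$ let $\Gamma(G,\mathcal{X})_\chi^{[r,\infty)}$ be its full subgraph on $\{g\mid\chi(g)\ge r\}$, and put $\Gamma(G,\mathcal{X})_\chi=\Gamma(G,\mathcal{X})_\chi^{[0,\infty)}$.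 The ray of a non-zero character $\chi$ in $\operatorname{Hom}(G,\mathbb{R})$ is $[\chi]=\{s\chi\mid s>0\}$, and $\Sigma^1(G)$ is the set of those rays $[\chi]$ for which $\Gamma(G,\mathcal{X})_\chi$ is connected for every generating system $\mathcal{X}$ of $G$. *Measured trees.* A measured tree is a triple $(T,\le,\lambda)$ consisting of a non-empty partially ordered set $(T,\le)$ in which every finite subset has a lower bound and every ray $(-\infty,a]=\{b\mid b\le a\}$ is linearly ordered, and a function $\lambda\colon T\to\mathbb{R}$ which maps each ray injectively and in an order-preserving way onto a subset of $\mathbb{R}$ that is not bounded from below. A subset $L\subseteq T$ is a line if it is linearly ordered, contains the ray $(-\infty,a]$ for each $a\in L$, and $\lambda(L)$ is not bounded from above. A measured $G$-tree is a measured tree on which $G$ acts in such a way that for each $g\in G$ the map $a\mapsto g.a$ is order-preserving and $\lambda(g.a)-\lambda(a)$ does not depend on $a$; its associated character is $\chi_T(g)=\lambda(g.a)-\lambda(a)$. The measured tree $T(G,\mathcal{X},\chi)$ is the set of all connected components $\mathcal{C}$ of the graphs $\Gamma(G,\mathcal{X})_\chi^{[r,\infty)}$ with $r\in\operatorname{im}\chi$,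 with $\mathcal{C}\le\mathcal{C}'\iff\mathcal{C}\supseteq\mathcal{C}'$ and $\lambda(\mathcal{C})=\inf\{\chi(h)\mid h\in\mathcal{C}\}$; it is a line if the whole set $T(G,\mathcal{X},\chi)$ is a line in the above sense. *$(G,\mathbb{R})$-trees.* An $\mathbb{R}$-tree is a metric space $(T,d)$ in which any two points $a,b$ are joined by a unique geodesic arc, with image $[a,b]$, and in which $[a,b]\cap[b,c]=\{b\}$ implies $[a,b]\cup[b,c]=[a,c]$; it is a $(G,\mathbb{R})$-tree if $G$ acts on it by isometries. An end $e$ is an equivalence class of infinite geodesic rays, two rays being equivalent if they have a common subray. For each $a\in T$ there is a unique ray $(-\infty,a]$ with end point $a$ that represents $e$; put $a_1\le a_2$ if $(-\infty,a_1]\subseteq(-\infty,a_2]$. With a base point $b_*\in T$ set $\lambda(x)=d(c,x)-d(c,b_*)$ for any $c$ with $c\le x$ and $c\le b_*$ (the value does not depend on $c$). If $G$ fixes $e$, the character associated to $e$ is $g\mapsto\lambda(g.x)-\lambda(x)$, which depends neither on $x$ nor on $b_*$. A line in an $\mathbb{R}$-tree is the image of an isometric embedding $\mathbb{R}\to T$.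 -/

import Mathlib

universe u

namespace SigmaOne

/-! ### Characters, generating systems, Cayley graphs and the invariant `Σ¹` -/

section Sigma

variable {G : Type u} [Group G]

/-- A character of `G` is a homomorphism of `G` into the additive group of the reals.
These form a real vector space. -/
abbrev Character (G : Type u) [Group G] : Type u := Additive G →+ ℝ

/-- The value of the character `χ` at the group element `g`. -/
def Character.val (χ : Character G) (g : G) : ℝ := χ (Additive.ofMul g)

/-- A generating system of `G` is a map `η : X → G` whose image generates `G`. -/
def IsGeneratingSystem {X : Type u} (η : X → G) : Prop :=
  Subgroup.closure (Set.range η) = ⊤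

/-- The full subgraph of the Cayley graph `Γ(G, X)` (edges join `g` to `g * η x`) on the vertices
`g` with `χ g ≥ r`. Orientation, loops and multiplicities of edges are forgotten, since only
connected components matter. -/
def upperGraph {X : Type u} (η : X → G) (χ : Character G) (r : ℝ) :
    SimpleGraph {g : G | r ≤ χ.val g} :=
  (SimpleGraph.mulCayley (Set.range η)).induce {g : G | r ≤ χ.val g}

/-- The character sphere: the set of rays `[χ]` with `χ` a non-zero character. -/
abbrev CharacterSphere (G : Type u) [Group G] : Type u := Module.Ray ℝ (Character G)

/-- The invariant `Σ¹(G)`: the set of all `[χ]` such that the subgraph of `Γ(G, X)` on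
`{g | χ g ≥ 0}` is connected for every generating system `η : X → G`. -/
def sigmaOne (G : Type u) [Group G] : Set (CharacterSphere G) :=
  {ρ | ∃ (χ : Character G) (hχ : χ ≠ 0), ρ = rayOfNeZero ℝ χ hχ ∧
    ∀ (X : Type u) (η : X → G), IsGeneratingSystem η → (upperGraph η χ 0).Connected}

end Sigma

/-! ### Measured trees -/

section Measured

variable {T : Type u} [PartialOrder T]

/-- `(T, ≤, lam)` is a measured tree. -/
structure IsMeasuredTree (lam : T → ℝ) : Prop where
  nonempty : Nonempty T
  bddBelow_of_finite : ∀ s : Set T, s.Finite → BddBelow s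
  isChain_ray : ∀ a : T, IsChain (· ≤ ·) (Set.Iic a)
  injOn_ray : ∀ a : T, Set.InjOn lam (Set.Iic a)
  monotoneOn_ray : ∀ a : T, MonotoneOn lam (Set.Iic a)
  not_bddBelow_ray : ∀ a : T, ¬ BddBelow (lam '' Set.Iic a)

/-- A line of `(T, ≤, lam)`: a linearly ordered subset that contains the ray descending from each
of its elements and on which `lam` is not bounded from above. -/
structure IsMeasuredLine (lam : T → ℝ) (L : Set T) : Prop where
  isChain : IsChain (· ≤ ·) L
  ray_subset : ∀ a ∈ L, Set.Iic a ⊆ L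
  not_bddAbove : ¬ BddAbove (lam '' L)

/-- A morphism of measured trees (here from a measured tree to itself). -/
def IsMeasuredEndomorphism (lam : T → ℝ) (φ : T → T) : Prop :=
  Monotone φ ∧ ∃ r : ℝ, ∀ a, lam (φ a) = lam a + r

/-- A measured `G`-tree: a measured tree on which the group `G` acts by morphisms. -/
structure IsMeasuredGTree (G : Type u) [Group G] [MulAction G T] (lam : T → ℝ) : Prop
    extends IsMeasuredTree lam where
  morphism : ∀ g : G, IsMeasuredEndomorphism lam (fun a : T => g • a)

end Measured

/-- The function `g ↦ lam (g • a) - lam a` does not depend on the point `a` and is equal to `χ`. -/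
def HasAssociatedCharacter {G : Type u} [Group G] {T : Type u} [MulAction G T]
    (lam : T → ℝ) (χ : Character G) : Prop :=
  ∀ (g : G) (a : T), lam (g • a) - lam a = χ.val g

/-- `L` is `G`-invariant. -/
def IsInvariantSet (G : Type u) [Group G] {T : Type u} [MulAction G T] (L : Set T) : Prop :=
  ∀ g : G, (fun x : T => g • x) '' L = L

/-! ### The measured tree `T(G, X, χ)` -/

section CayleyTree

variable {G : Type u} [Group G] {X : Type u}

/-- The points of `T(G, X, χ)`: the connected components of the graphs `upperGraph η χ r`, with `r`
in the image of `χ`. These are full subgraphs of the Cayley graph, and are represented by their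
vertex sets. -/
def CayleyTree (η : X → G) (χ : Character G) : Type u :=
  {C : Set G // ∃ r ∈ Set.range χ.val, ∃ c : (upperGraph η χ r).ConnectedComponent,
    C = Subtype.val '' c.supp}

/-- The order of `T(G, X, χ)` is reverse inclusion. -/
instance CayleyTree.instPartialOrder (η : X → G) (χ : Character G) :
    PartialOrder (CayleyTree η χ) where
  le C C' := C'.1 ⊆ C.1
  le_refl C := Set.Subset.refl C.1
  le_trans _ _ _ h h' := Set.Subset.trans h' h
  le_antisymm _ _ h h' := Subtype.ext (Set.Subset.antisymm h' h)

/-- The measure of `T(G, X, χ)`: the infimum of `χ` on a component. -/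
noncomputable def CayleyTree.lam (η : X → G) (χ : Character G) (C : CayleyTree η χ) : ℝ :=
  sInf (χ.val '' C.1)

end CayleyTree

/-! ### `ℝ`-trees, their ends and the associated measures -/

section RTree

variable {T : Type u} [MetricSpace T]

/-- `γ` is a geodesic arc from `a` to `b`, parametrized by `[0, d(a, b)]`. -/
def IsGeodesicArc (a b : T) (γ : Set.Icc (0 : ℝ) (dist a b) → T) : Prop :=
  Isometry γ ∧ γ ⟨0, le_refl 0, dist_nonneg⟩ = a ∧ γ ⟨dist a b, dist_nonneg, le_refl _⟩ = b

/-- The geodesic segment `[a, b]`, the image of the geodesic arc from `a` to `b`. -/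
def geodesicSegment (a b : T) : Set T :=
  {x | ∃ γ, IsGeodesicArc a b γ ∧ x ∈ Set.range γ}

/-- `ℝ`-trees: any two points are joined by a unique geodesic arc, and two segments `[a, b]`,
`[b, c]` having only `b` in common make up the segment `[a, c]`. -/
structure IsRTree (T : Type u) [MetricSpace T] : Prop where
  existsUnique_arc : ∀ a b : T, ∃! γ, IsGeodesicArc a b γ
  union_segment : ∀ a b c : T, geodesicSegment a b ∩ geodesicSegment b c = {b} →
    geodesicSegment a b ∪ geodesicSegment b c = geodesicSegment a c

/-- A geodesic ray of infinite length, parametrized by the distance from its end point. -/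
structure GeodesicRay (T : Type u) [MetricSpace T] where
  toFun : NNReal → T
  isometry : Isometry toFun

/-- Two geodesic rays represent the same end if they have a common subray. -/
def GeodesicRay.Equivalent (ρ σ : GeodesicRay T) : Prop :=
  ∃ s t : NNReal, ∀ v : NNReal, ρ.toFun (s + v) = σ.toFun (t + v)

/-- The relation `GeodesicRay.Equivalent` is an equivalence relation. -/
instance GeodesicRay.setoid (T : Type u) [MetricSpace T] : Setoid (GeodesicRay T) where
  r := GeodesicRay.Equivalent
  iseqv :=
    { refl := fun _ => ⟨0, 0, fun _ => rfl⟩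
      symm := fun ⟨s, t, h⟩ => ⟨t, s, fun v => (h v).symm⟩
      trans := by
        rintro ρ σ τ ⟨s, t, h⟩ ⟨s', t', h'⟩
        refine ⟨s + s', t' + t, fun v => ?_⟩
        rw [add_assoc, h, add_assoc t', ← h', ← add_assoc, ← add_assoc, add_comm t s'] }

/-- An end: an equivalence class of geodesic rays. -/
def TreeEnd (T : Type u) [MetricSpace T] : Type u := Quotient (GeodesicRay.setoid T)

/-- The geodesic ray `(-∞, a]` that represents the end `e` and has end point `a`, as a set. -/
def descendingRay (e : TreeEnd T) (a : T) : Set T :=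
  {x | ∃ ρ : GeodesicRay T, (Quotient.mk _ ρ : TreeEnd T) = e ∧ ρ.toFun 0 = a ∧
    x ∈ Set.range ρ.toFun}

/-- The order relation attached to the end `e`. -/
def endLE (e : TreeEnd T) (a₁ a₂ : T) : Prop := descendingRay e a₁ ⊆ descendingRay e a₂

/-- The measure attached to the end `e` and the base point `b`: one has
`endMeasure e b x = d(c, x) - d(c, b)` for any `c` with `c ≤ x` and `c ≤ b`; in an `ℝ`-tree such
`c` exist and the value does not depend on the choice of `c`. -/
noncomputable def endMeasure (e : TreeEnd T) (b x : T) : ℝ :=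
  let c := @Classical.epsilon T ⟨b⟩ (fun c => endLE e c x ∧ endLE e c b)
  dist c x - dist c b

/-- A (geodesic) line: an isometrically embedded copy of `ℝ`. -/
def IsGeodesicLine (L : Set T) : Prop := ∃ φ : ℝ → T, Isometry φ ∧ Set.range φ = L

variable (G : Type u) [Group G] [MulAction G T] [IsIsometricSMul G T]

variable {G} in
/-- The translate of a geodesic ray by a group element. -/
def GeodesicRay.translate (g : G) (ρ : GeodesicRay T) : GeodesicRay T where
  toFun v := g • ρ.toFun v
  isometry := (isometry_smul T g).comp ρ.isometry

variable {G} in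
/-- The translate of an end by a group element. -/
def TreeEnd.translate (g : G) : TreeEnd T → TreeEnd T :=
  Quotient.map (GeodesicRay.translate g) (by
    rintro ρ σ ⟨s, t, h⟩
    exact ⟨s, t, fun v => congrArg (fun x => g • x) (h v)⟩)

/-- The group `G` fixes the end `e`. -/
def FixesEnd (e : TreeEnd T) : Prop := ∀ g : G, TreeEnd.translate g e = e

end RTree

end SigmaOne

/-! In all four statements `G` acts on a tree, shifting heights by `χ`. An invariant line arises
once some orbit is linearly ordered, and paths in the graph on `χ ≥ 0` are what makes orbit points
comparable.

1 ⇔ 2: if that graph is connected, left translation shows that the components forming the tree are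
the half-spaces `χ ≥ χ a`, which are nested. Conversely, two components of the same level that are
comparable coincide (`CayleyTree.isMeasuredLine_univ_iff`).

1 ⇒ 3: pick `t` with `χ t > 0` and a point `c ≤ t • c`. The elements `x` with `c ≤ x • c` generate
`G`. Connectedness for this generating system spreads the inequality to every `g` with `χ g ≥ 0`, so
the orbit of `c` is a chain and the points below it form the line
(`IsMeasuredGTree.exists_invariant_line`).

3 ⇒ 4: a fixed end orders the `ℝ`-tree, and `endMeasure` turns it into a measured `G`-tree.
Distances between comparable points are differences of measure, so measured lines are geodesic
lines.

4 ⇒ 1: for a given `η`, the supremum `joinLevel` of the levels at which two elements can be joined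
is an ultrametric kernel. Gluing descending rays along it gives an `ℝ`-tree with a fixed end and
character `χ`. On an invariant line, orbits reach arbitrarily low, which forces comparability; hence
all `h` with `χ h ≥ 0` can be joined to `1` at one common level, and
`upperGraph_connected_of_joined` raises this level to `0`. -/

namespace SigmaOne

/-! ### Values of characters -/

section Characters

variable {G : Type u} [Group G] (χ : Character G)

@[simp] theorem Character.val_one : χ.val 1 = 0 := map_zero χ

@[simp] theorem Character.val_mul (g h : G) : χ.val (g * h) = χ.val g + χ.val h :=
  map_add χ (Additive.ofMul g) (Additive.ofMul h)

@[simp] theorem Character.val_inv (g : G) : χ.val g⁻¹ = -χ.val g :=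
  map_neg χ (Additive.ofMul g)

@[simp] theorem Character.val_pow (g : G) (n : ℕ) : χ.val (g ^ n) = n * χ.val g := by
  induction n with
  | zero => simp
  | succ n ih => rw [pow_succ, val_mul, ih]; push_cast; ring

variable {χ}

theorem Character.exists_val_pos (hχ : χ ≠ 0) : ∃ t : G, 0 < χ.val t := by
  by_contra! h
  refine hχ (AddMonoidHom.ext fun g => le_antisymm (h g.toMul) ?_)
  have := h g.toMul⁻¹
  rw [val_inv] at this
  exact neg_nonpos.1 this

theorem Character.exists_lt_val (hχ : χ ≠ 0) (r : ℝ) : ∃ g : G, r < χ.val g := by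
  obtain ⟨t, ht⟩ := exists_val_pos hχ
  obtain ⟨n, hn⟩ := exists_nat_gt (r / χ.val t)
  exact ⟨t ^ n, by rw [val_pow]; exact (div_lt_iff₀ ht).1 hn⟩

end Characters

/-! ### Paths in superlevel graphs, and independence of the representative of a ray -/

section Joined

variable {G : Type u} [Group G] {X : Type u} {η : X → G} {χ : Character G}

/-- The vertices `g` and `h` lie in the same component of `upperGraph η χ r`. -/
def Joined (η : X → G) (χ : Character G) (r : ℝ) (g h : G) : Prop :=
  ∃ (hg : r ≤ χ.val g) (hh : r ≤ χ.val h), (upperGraph η χ r).Reachable ⟨g, hg⟩ ⟨h, hh⟩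

namespace Joined

theorem refl {r : ℝ} {g : G} (hg : r ≤ χ.val g) : Joined η χ r g g := ⟨hg, hg, .refl _⟩

theorem symm {r : ℝ} {g h : G} : Joined η χ r g h → Joined η χ r h g :=
  fun ⟨hg, hh, p⟩ => ⟨hh, hg, p.symm⟩

theorem trans {r : ℝ} {g h k : G} : Joined η χ r g h → Joined η χ r h k → Joined η χ r g k :=
  fun ⟨hg, _, p⟩ ⟨_, hk, q⟩ => ⟨hg, hk, p.trans q⟩

theorem le_left {r : ℝ} {g h : G} (H : Joined η χ r g h) : r ≤ χ.val g := H.1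

theorem le_right {r : ℝ} {g h : G} (H : Joined η χ r g h) : r ≤ χ.val h := H.2.1

theorem step {r : ℝ} {g : G} {x : X} (hg : r ≤ χ.val g) (hx : r ≤ χ.val (g * η x)) :
    Joined η χ r g (g * η x) := by
  by_cases h : g = g * η x
  · rw [← h]; exact refl hg
  · refine ⟨hg, hx, SimpleGraph.Adj.reachable ?_⟩
    exact (SimpleGraph.mulCayley_adj' _ _ _).2 ⟨h, η x, ⟨x, rfl⟩, Or.inl rfl⟩

/-- Induction along a path, phrased for group elements instead of vertices of a subtype. An edge may
be traversed with or against its label, hence two step hypotheses. -/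
theorem prop_of_step {r : ℝ} {g h : G} {P : G → Prop} (H : Joined η χ r g h) (base : P g)
    (up : ∀ k x, r ≤ χ.val k → r ≤ χ.val (k * η x) → P k → P (k * η x))
    (down : ∀ k x, r ≤ χ.val k → r ≤ χ.val (k * η x) → P (k * η x) → P k) : P h := by
  obtain ⟨hg, hh, ⟨p⟩⟩ := H
  suffices ∀ a b : {g : G | r ≤ χ.val g}, (upperGraph η χ r).Walk a b → P a → P b from
    this _ _ p base
  intro a b p
  induction p with
  | nil => exact id
  | @cons a b c hab _ ih =>
    intro ha
    apply ih
    obtain ⟨-, _, ⟨x, rfl⟩, hx | hx⟩ := (SimpleGraph.mulCayley_adj' _ _ _).1 hab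
    · rw [Function.Embedding.subtype_apply, Function.Embedding.subtype_apply] at hx
      rw [← hx]
      exact up _ _ a.2 (hx ▸ b.2) ha
    · rw [Function.Embedding.subtype_apply, Function.Embedding.subtype_apply] at hx
      exact down _ x b.2 (hx ▸ a.2) (hx ▸ ha)

@[elab_as_elim]
theorem induction_on {r : ℝ} {g h : G} {P : ∀ k, Joined η χ r g k → Prop} (H : Joined η χ r g h)
    (base : ∀ hg : r ≤ χ.val g, P g (refl hg))
    (up : ∀ k x (H : Joined η χ r g k) (hx : r ≤ χ.val (k * η x)), P k H →
      P (k * η x) (H.trans (step H.le_right hx)))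
    (down : ∀ k x (hk : r ≤ χ.val k) (H : Joined η χ r g (k * η x)), P (k * η x) H →
      P k (H.trans (step hk H.le_right).symm)) : P h H := by
  suffices ∃ H, P h H from this.2
  refine prop_of_step (P := fun k => ∃ H, P k H) H ⟨_, base H.le_left⟩ ?_ ?_
  · exact fun k x _ hx ⟨H, hH⟩ => ⟨_, up k x H hx hH⟩
  · exact fun k x hk _ ⟨H, hH⟩ => ⟨_, down k x hk H hH⟩

theorem mono {r s : ℝ} {g h : G} (H : Joined η χ r g h) (hs : s ≤ r) : Joined η χ s g h := by
  have h0 : s ≤ χ.val g := hs.trans H.le_left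
  induction H using induction_on with
  | base => exact refl h0
  | up k x H hx ih => exact ih.trans (step (hs.trans H.le_right) (hs.trans hx))
  | down k x hk H ih => exact ih.trans (step (hs.trans hk) (hs.trans H.le_right)).symm

theorem smul {r : ℝ} {g h : G} (H : Joined η χ r g h) (k : G) :
    Joined η χ (χ.val k + r) (k * g) (k * h) := by
  have key : ∀ l, r ≤ χ.val l → χ.val k + r ≤ χ.val (k * l) := fun l hl => by
    rw [Character.val_mul]; linarith
  have h0 := key g H.le_left
  induction H using induction_on with
  | base => exact refl h0
  | up l x H hx ih =>
    have := key _ hx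
    rw [← mul_assoc] at this ⊢
    exact ih.trans (step (key _ H.le_right) this)
  | down l x hl H ih =>
    have := key _ H.le_right
    rw [← mul_assoc] at this ih
    exact ih.trans (step (key _ hl) this).symm

/-- The full Cayley graph is connected, and `χ` has a minimum on a finite path. -/
theorem exists_level (hη : IsGeneratingSystem η) (χ : Character G) (g h : G) :
    ∃ r, Joined η χ r g h := by
  suffices ∀ k : G, ∀ g, ∃ r, Joined η χ r g (g * k) by
    simpa using this (g⁻¹ * h) g
  intro k
  have hk : k ∈ Subgroup.closure (Set.range η) := by rw [hη]; trivial
  induction hk using Subgroup.closure_induction with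
  | mem k hk =>
    obtain ⟨x, rfl⟩ := hk
    exact fun g => ⟨min (χ.val g) (χ.val (g * η x)), step (min_le_left _ _) (min_le_right _ _)⟩
  | one => exact fun g => ⟨χ.val g, by rw [mul_one]; exact refl le_rfl⟩
  | mul a b _ _ iha ihb =>
    intro g
    obtain ⟨r, hr⟩ := iha g
    obtain ⟨s, hs⟩ := ihb (g * a)
    refine ⟨min r s, ?_⟩
    rw [← mul_assoc]
    exact (hr.mono (min_le_left _ _)).trans (hs.mono (min_le_right _ _))
  | inv a _ ih =>
    intro g
    obtain ⟨r, hr⟩ := ih (g * a⁻¹)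
    rw [inv_mul_cancel_right] at hr
    exact ⟨r, hr.symm⟩

end Joined

theorem upperGraph_connected_iff :
    (upperGraph η χ 0).Connected ↔ ∀ g, 0 ≤ χ.val g → Joined η χ 0 1 g := by
  have h1 : 0 ≤ χ.val (1 : G) := by simp
  constructor
  · exact fun H g hg => ⟨h1, hg, H.preconnected _ _⟩
  · intro H
    have : Nonempty {g : G | 0 ≤ χ.val g} := ⟨⟨1, h1⟩⟩
    refine ⟨fun a b => ?_⟩
    obtain ⟨_, _, p⟩ := (H a a.2).symm.trans (H b b.2)
    exact p

theorem upperGraph_smul_connected_iff {s : ℝ} (hs : 0 < s) :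
    (upperGraph η (s • χ) 0).Connected ↔ (upperGraph η χ 0).Connected := by
  have key : ∀ g : G, 0 ≤ (s • χ : Character G).val g ↔ 0 ≤ χ.val g := fun g =>
    mul_nonneg_iff_of_pos_left hs
  rw [upperGraph_connected_iff, upperGraph_connected_iff]
  refine forall_congr' fun g => imp_congr (key g) ⟨fun H => ?_, fun H => ?_⟩
  · induction H using Joined.induction_on with
    | base => exact Joined.refl (by simp)
    | up k x H hx ih => exact ih.trans (Joined.step ((key _).1 H.le_right) ((key _).1 hx))
    | down k x hk H ih => exact ih.trans (Joined.step ((key _).1 hk) ((key _).1 H.le_right)).symm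
  · induction H using Joined.induction_on with
    | base => exact Joined.refl (by simp)
    | up k x H hx ih => exact ih.trans (Joined.step ((key _).2 H.le_right) ((key _).2 hx))
    | down k x hk H ih => exact ih.trans (Joined.step ((key _).2 hk) ((key _).2 H.le_right)).symm

theorem rayOfNeZero_mem_sigmaOne_iff (hχ : χ ≠ 0) :
    rayOfNeZero ℝ χ hχ ∈ sigmaOne G ↔
      ∀ (X : Type u) (η : X → G), IsGeneratingSystem η → (upperGraph η χ 0).Connected := by
  refine ⟨?_, fun H => ⟨χ, hχ, rfl, H⟩⟩
  rintro ⟨ψ, hψ, h, H⟩ X η hη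
  obtain ⟨s, hs, rfl⟩ := ((ray_eq_iff hχ hψ).1 h).exists_pos_left hχ hψ
  exact (upperGraph_smul_connected_iff hs).1 (H X η hη)

end Joined

/-! ### The tree `T(G, X, χ)`: equivalence of 1 and 2 -/

section CayleyTree

variable {G : Type u} [Group G] {X : Type u} {η : X → G} {χ : Character G}

theorem Joined.of_connected (H : (upperGraph η χ 0).Connected) {a g h : G}
    (hg : χ.val a ≤ χ.val g) (hh : χ.val a ≤ χ.val h) : Joined η χ (χ.val a) g h := by
  rw [upperGraph_connected_iff] at H
  have key : ∀ k, χ.val a ≤ χ.val k → Joined η χ (χ.val a) a k := fun k hk => by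
    simpa using (H (a⁻¹ * k) (by simpa using hk)).smul a
  exact (key g hg).symm.trans (key h hh)

theorem CayleyTree.exists_eq_of_connected (H : (upperGraph η χ 0).Connected)
    (C : CayleyTree η χ) : ∃ a, C.1 = {g | χ.val a ≤ χ.val g} := by
  obtain ⟨C, _, ⟨a, rfl⟩, c, rfl⟩ := C
  refine ⟨a, Set.ext fun g => ⟨?_, fun hg => ?_⟩⟩
  · rintro ⟨g, -, rfl⟩
    exact g.2
  · refine ⟨⟨g, hg⟩, ?_, rfl⟩
    induction c using SimpleGraph.ConnectedComponent.ind with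
    | h b =>
      obtain ⟨_, _, p⟩ := Joined.of_connected H hg b.2
      exact SimpleGraph.ConnectedComponent.sound p

theorem CayleyTree.lam_eq {C : CayleyTree η χ} {a : G} (h : C.1 = {g | χ.val a ≤ χ.val g}) :
    CayleyTree.lam η χ C = χ.val a := by
  refine IsLeast.csInf_eq ⟨⟨a, h ▸ le_refl (χ.val a), rfl⟩, ?_⟩
  rintro _ ⟨g, hg, rfl⟩
  rw [h] at hg
  exact hg

theorem CayleyTree.isMeasuredLine_univ_iff (hχ : χ ≠ 0) :
    IsMeasuredLine (CayleyTree.lam η χ) Set.univ ↔ (upperGraph η χ 0).Connected := by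
  constructor
  · intro H
    have h0 : 0 ≤ χ.val (1 : G) := by simp
    have : Nonempty {g : G | 0 ≤ χ.val g} := ⟨⟨1, h0⟩⟩
    refine ⟨fun a b => ?_⟩
    let C (a : {g : G | 0 ≤ χ.val g}) : CayleyTree η χ :=
      ⟨Subtype.val '' ((upperGraph η χ 0).connectedComponentMk a).supp, 0, ⟨1, by simp⟩, _, rfl⟩
    -- Both components have level `0`, so an inclusion between them already forces equality.
    have key : ∀ a b, C a ≤ C b → (upperGraph η χ 0).Reachable b a := by
      intro a b h
      obtain ⟨b', hb, he⟩ := h ⟨b, rfl, rfl⟩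
      rw [← Subtype.ext he]
      exact SimpleGraph.ConnectedComponent.exact hb
    rcases H.isChain.total (Set.mem_univ (C a)) (Set.mem_univ (C b)) with h | h
    · exact (key _ _ h).symm
    · exact key _ _ h
  · intro H
    refine ⟨fun C _ D _ _ => ?_, fun _ _ => Set.subset_univ _, ?_⟩
    · obtain ⟨a, ha⟩ := exists_eq_of_connected H C
      obtain ⟨b, hb⟩ := exists_eq_of_connected H D
      rcases le_total (χ.val a) (χ.val b) with h | h
      · refine Or.inl (show D.1 ⊆ C.1 from ?_)
        rw [ha, hb]
        exact fun g hg => h.trans hg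
      · refine Or.inr (show C.1 ⊆ D.1 from ?_)
        rw [ha, hb]
        exact fun g hg => h.trans hg
    · rintro ⟨r, hr⟩
      obtain ⟨g, hg⟩ := Character.exists_lt_val hχ r
      let C : CayleyTree η χ :=
        ⟨Subtype.val '' ((upperGraph η χ (χ.val g)).connectedComponentMk ⟨g, le_refl (χ.val g)⟩).supp,
          _, ⟨g, rfl⟩, _, rfl⟩
      have hC : C.1 = {h | χ.val g ≤ χ.val h} := by
        refine Set.ext fun h => ⟨?_, fun hh => ?_⟩
        · rintro ⟨h, -, rfl⟩
          exact h.2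
        · obtain ⟨_, _, p⟩ := Joined.of_connected H hh (le_refl (χ.val g))
          exact ⟨⟨h, hh⟩, SimpleGraph.ConnectedComponent.sound p, rfl⟩
      have := hr ⟨C, trivial, rfl⟩
      rw [lam_eq hC] at this
      exact absurd hg this.not_gt

end CayleyTree

/-! ### Invariant lines in measured `G`-trees: 1 implies 3 -/

section MeasuredGTree

variable {G : Type u} [Group G] {χ : Character G} {T : Type u} [PartialOrder T] [MulAction G T]
  {lam : T → ℝ}

/-- Below a common upper bound the order can be read off from `lam`. This is how inequalities
between values of `χ` become inequalities in the tree. -/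
theorem IsMeasuredTree.le_of_le_of_le (h : IsMeasuredTree lam) {a b c : T} (ha : a ≤ c)
    (hb : b ≤ c) (hab : lam a ≤ lam b) : a ≤ b := by
  rcases (h.isChain_ray c).total ha hb with H | H
  · exact H
  · exact (h.injOn_ray c ha hb (hab.antisymm (h.monotoneOn_ray c hb ha H))).le

theorem IsMeasuredTree.exists_le_le (h : IsMeasuredTree lam) (a b : T) : ∃ c, c ≤ a ∧ c ≤ b := by
  obtain ⟨c, hc⟩ := h.bddBelow_of_finite {a, b} (by simp)
  exact ⟨c, hc (by simp), hc (by simp)⟩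

theorem IsMeasuredGTree.smul_le_smul (h : IsMeasuredGTree G lam) (g : G) {a b : T} (hab : a ≤ b) :
    g • a ≤ g • b := (h.morphism g).1 hab

/-- The elements moving `c` upwards generate `G` if one of them has positive `χ`-value. -/
theorem IsMeasuredGTree.closure_setOf_le_smul (h : IsMeasuredGTree G lam)
    (hlam : HasAssociatedCharacter lam χ) {t : G} (ht : 0 < χ.val t) {c : T} (hc : c ≤ t • c) :
    Subgroup.closure {x : G | c ≤ x • c} = ⊤ := by
  have hpow : ∀ n : ℕ, c ≤ t ^ n • c := by
    intro n
    induction n with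
    | zero => simp
    | succ n ih =>
      rw [pow_succ', mul_smul]
      exact hc.trans (h.smul_le_smul t ih)
  refine (Subgroup.eq_top_iff' _).2 fun g => ?_
  -- A high power of `t⁻¹` moves `c` below `d`, hence below `g • c`. Then `t ^ n` and `t ^ n * g`
  -- both move `c` upwards, and `g` is a quotient of the two.
  obtain ⟨d, hd, hd'⟩ := h.exists_le_le c (g • c)
  obtain ⟨n, hn⟩ := exists_nat_gt ((lam c - lam d) / χ.val t)
  rw [div_lt_iff₀ ht] at hn
  have h1 : (t ^ n)⁻¹ • c ≤ c := by simpa using h.smul_le_smul (t ^ n)⁻¹ (hpow n)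
  have h2 : (t ^ n)⁻¹ • c ≤ d := by
    refine h.le_of_le_of_le h1 hd ?_
    have := hlam (t ^ n)⁻¹ c
    rw [Character.val_inv, Character.val_pow] at this
    linarith
  have h3 : c ≤ (t ^ n * g) • c := by
    simpa [mul_smul] using h.smul_le_smul (t ^ n) (h2.trans hd')
  have := Subgroup.mul_mem _
    (Subgroup.inv_mem _ (Subgroup.subset_closure (k := {x : G | c ≤ x • c}) (hpow n)))
    (Subgroup.subset_closure (k := {x : G | c ≤ x • c}) h3)
  rwa [inv_mul_cancel_left] at this

theorem IsMeasuredGTree.exists_invariant_line (hχ : χ ≠ 0)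
    (H : ∀ (X : Type u) (η : X → G), IsGeneratingSystem η → (upperGraph η χ 0).Connected)
    (h : IsMeasuredGTree G lam) (hlam : HasAssociatedCharacter lam χ) :
    ∃ L : Set T, IsMeasuredLine lam L ∧ IsInvariantSet G L := by
  obtain ⟨t, ht⟩ := Character.exists_val_pos hχ
  obtain ⟨b⟩ := h.nonempty
  obtain ⟨c, hcb, hc⟩ := h.exists_le_le (t • b) b
  -- Both points lie below `t • b`, and `t` raises the measure.
  have htc : c ≤ t • c := by
    refine h.le_of_le_of_le hcb (h.smul_le_smul t hc) ?_
    have := hlam t c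
    linarith
  let η : {x : G | c ≤ x • c} → G := Subtype.val
  have hη : IsGeneratingSystem η := by
    rw [IsGeneratingSystem, Subtype.range_coe]
    exact h.closure_setOf_le_smul hlam ht htc
  have base : ∀ g, 0 ≤ χ.val g → c ≤ g • c := by
    intro g hg
    have hJ := upperGraph_connected_iff.1 (H _ η hη) g hg
    clear hg
    induction hJ using Joined.induction_on with
    | base => simp
    | up k x _ _ ih =>
      rw [mul_smul]
      exact ih.trans (h.smul_le_smul k x.2)
    -- Here `c` and `k • c` both lie below `(k * η x) • c`, and `χ k ≥ 0` decides which is lower.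
    | down k x hk _ ih =>
      refine h.le_of_le_of_le ih ?_ ?_
      · rw [mul_smul]
        exact h.smul_le_smul k x.2
      · have := hlam k c
        linarith
  have comparable : ∀ g k : G, χ.val g ≤ χ.val k → g • c ≤ k • c := by
    intro g k hgk
    simpa [mul_smul] using h.smul_le_smul g (base (g⁻¹ * k) (by simpa using hgk))
  have invariant : ∀ g : G, ∀ a ∈ {a : T | ∃ g : G, a ≤ g • c},
      g • a ∈ {a : T | ∃ g : G, a ≤ g • c} := by
    rintro g a ⟨k, hk⟩
    exact ⟨g * k, by rw [mul_smul]; exact h.smul_le_smul g hk⟩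
  refine ⟨{a | ∃ g : G, a ≤ g • c}, ⟨?_, ?_, ?_⟩, fun g => Set.Subset.antisymm ?_ ?_⟩
  · rintro a ⟨g, hg⟩ a' ⟨k, hk⟩ -
    rcases le_total (χ.val g) (χ.val k) with hgk | hgk
    · exact (h.isChain_ray _).total (hg.trans (comparable _ _ hgk)) hk
    · exact (h.isChain_ray _).total hg (hk.trans (comparable _ _ hgk))
  · rintro a ⟨g, hg⟩ b hb
    exact ⟨g, le_trans hb hg⟩
  · rintro ⟨r, hr⟩
    obtain ⟨g, hg⟩ := Character.exists_lt_val hχ (r - lam c)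
    have h1 := hr ⟨g • c, ⟨g, le_rfl⟩, rfl⟩
    have h2 := hlam g c
    linarith
  · rintro _ ⟨a, ha, rfl⟩
    exact invariant g a ha
  · exact fun a ha => ⟨g⁻¹ • a, invariant g⁻¹ a ha, by simp⟩

end MeasuredGTree

/-! ### Segments and rays in `ℝ`-trees -/

section RTree

variable {T : Type u} [MetricSpace T]

theorem IsRTree.eq_of_arc (hT : IsRTree T) {a b : T} {γ δ : Set.Icc (0 : ℝ) (dist a b) → T}
    (hγ : IsGeodesicArc a b γ) (hδ : IsGeodesicArc a b δ) : γ = δ :=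
  (hT.existsUnique_arc a b).unique hγ hδ

/-- The restriction to `[0, d(a, b)]` of a map that is isometric on this interval is a geodesic
arc. -/
theorem isGeodesicArc_of_dist_eq {a b : T} {f : ℝ → T} (h0 : f 0 = a) (h1 : f (dist a b) = b)
    (h : ∀ u v, 0 ≤ u → u ≤ v → v ≤ dist a b → dist (f u) (f v) = v - u) :
    IsGeodesicArc a b (fun v => f v) := by
  refine ⟨Isometry.of_dist_eq fun u v => ?_, h0, h1⟩
  rcases le_total (u : ℝ) v with huv | huv
  · rw [h _ _ u.2.1 huv v.2.2, Subtype.dist_eq, Real.dist_eq, abs_sub_comm,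
      abs_of_nonneg (sub_nonneg.2 huv)]
  · rw [dist_comm, h _ _ v.2.1 huv u.2.2, Subtype.dist_eq, Real.dist_eq,
      abs_of_nonneg (sub_nonneg.2 huv)]

/-- Two maps that are isometric on an interval and have the same end points agree on it. -/
theorem IsRTree.eqOn_of_dist_eq (hT : IsRTree T) {f g : ℝ → T} {D : ℝ} (hD : 0 ≤ D)
    (hf : ∀ u v, 0 ≤ u → u ≤ v → v ≤ D → dist (f u) (f v) = v - u)
    (hg : ∀ u v, 0 ≤ u → u ≤ v → v ≤ D → dist (g u) (g v) = v - u)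
    (h0 : f 0 = g 0) (h1 : f D = g D) : Set.EqOn f g (Set.Icc 0 D) := by
  have hd : dist (f 0) (f D) = D := by rw [hf 0 D le_rfl hD le_rfl, sub_zero]
  have hf' : IsGeodesicArc (f 0) (f D) (fun v => f v) :=
    isGeodesicArc_of_dist_eq rfl (by rw [hd]) (by rwa [hd])
  have hg' : IsGeodesicArc (f 0) (f D) (fun v => g v) :=
    isGeodesicArc_of_dist_eq h0.symm (by rw [hd, h1]) (by rwa [hd])
  intro v hv
  exact congrFun (hT.eq_of_arc hf' hg') ⟨v, by rwa [hd]⟩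

theorem dist_add_dist_of_mem_segment {a b x : T} (hx : x ∈ geodesicSegment a b) :
    dist a x + dist x b = dist a b := by
  obtain ⟨γ, ⟨h, h0, h1⟩, v, rfl⟩ := hx
  have e0 := h.dist_eq ⟨0, le_rfl, dist_nonneg⟩ v
  have e1 := h.dist_eq v ⟨dist a b, dist_nonneg, le_rfl⟩
  rw [h0, Subtype.dist_eq, Real.dist_eq, abs_sub_comm, sub_zero, abs_of_nonneg v.2.1] at e0
  rw [h1, Subtype.dist_eq, Real.dist_eq, abs_sub_comm, abs_of_nonneg (sub_nonneg.2 v.2.2)] at e1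
  rw [e0, e1]
  ring

theorem mem_segment_of_isGeodesicArc {a b : T} {γ : Set.Icc (0 : ℝ) (dist a b) → T}
    (hγ : IsGeodesicArc a b γ) (v) : γ v ∈ geodesicSegment a b := ⟨γ, hγ, v, rfl⟩

theorem IsRTree.exists_extension (hT : IsRTree T) (a b : T) :
    ∃ f : ℝ → T, f 0 = a ∧ f (dist a b) = b ∧
      (∀ u v, 0 ≤ u → u ≤ v → v ≤ dist a b → dist (f u) (f v) = v - u) ∧
      geodesicSegment a b = f '' Set.Icc 0 (dist a b) := by
  obtain ⟨γ, hγ, -⟩ := hT.existsUnique_arc a b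
  have hd : (0 : ℝ) ≤ dist a b := dist_nonneg
  refine ⟨Set.IccExtend hd γ, ?_, ?_, ?_, ?_⟩
  · rw [Set.IccExtend_left]; exact hγ.2.1
  · rw [Set.IccExtend_right]; exact hγ.2.2
  · intro u v hu huv hv
    rw [Set.IccExtend_of_mem hd γ ⟨hu, huv.trans hv⟩, Set.IccExtend_of_mem hd γ ⟨hu.trans huv, hv⟩,
      hγ.1.dist_eq, Subtype.dist_eq, Real.dist_eq, abs_sub_comm, abs_of_nonneg (sub_nonneg.2 huv)]
  · ext x
    constructor
    · rintro ⟨δ, hδ, v, rfl⟩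
      rw [hT.eq_of_arc hδ hγ]
      exact ⟨v, v.2, Set.IccExtend_val hd γ v⟩
    · rintro ⟨v, hv, rfl⟩
      rw [Set.IccExtend_of_mem hd γ hv]
      exact mem_segment_of_isGeodesicArc hγ _

/-- A point of an `ℝ`-tree is determined by its distances from the end points of a segment on
which it lies. -/
theorem IsRTree.mem_segment_iff (hT : IsRTree T) {a b x : T} :
    x ∈ geodesicSegment a b ↔ dist a x + dist x b = dist a b := by
  refine ⟨dist_add_dist_of_mem_segment, fun h => ?_⟩
  obtain ⟨f, f0, f1, hf, -⟩ := hT.exists_extension a x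
  obtain ⟨g, g0, g1, hg, -⟩ := hT.exists_extension x b
  -- The concatenation of the arcs through `x` is itself geodesic, because the triangle inequality
  -- for `a, x, b` is an equality.
  let k : ℝ → T := fun v => if v ≤ dist a x then f v else g (v - dist a x)
  have hax : 0 ≤ dist a x := dist_nonneg
  have hxb : 0 ≤ dist x b := dist_nonneg
  have k0 : k 0 = a := by simp [k, hax, f0]
  have k1 : k (dist a b) = b := by
    by_cases hb : dist a b ≤ dist a x
    · have : x = b := dist_eq_zero.1 (by linarith)
      subst this
      simp [k, f1]
    · simp only [k, if_neg hb]
      rw [← h, add_sub_cancel_left, g1]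
  have hk : ∀ u v, 0 ≤ u → u ≤ v → v ≤ dist a b → dist (k u) (k v) = v - u := by
    intro u v hu huv hv
    by_cases hv' : v ≤ dist a x
    · simp only [k, if_pos hv', if_pos (huv.trans hv')]
      exact hf u v hu huv hv'
    by_cases hu' : u ≤ dist a x
    · have e0 := hf 0 u le_rfl hu hu'
      have e1 := hf u _ hu hu' le_rfl
      have e2 := hg 0 (v - dist a x) le_rfl (by linarith) (by linarith)
      have e3 := hg (v - dist a x) _ (by linarith) (by linarith) le_rfl
      simp only [k, if_neg hv', if_pos hu']
      rw [f0] at e0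
      rw [f1] at e1
      rw [g0] at e2
      rw [g1] at e3
      have t1 := dist_triangle (f u) x (g (v - dist a x))
      have t2 := dist_triangle4 a (f u) (g (v - dist a x)) b
      linarith
    · simp only [k, if_neg hv', if_neg hu']
      rw [hg _ _ (by linarith) (by linarith) (by linarith)]
      ring
  have := mem_segment_of_isGeodesicArc (isGeodesicArc_of_dist_eq k0 k1 hk)
    ⟨dist a x, hax, by linarith⟩
  simpa [k, f1] using this

theorem IsRTree.eq_of_mem_segment (hT : IsRTree T) {a b x y : T} (hx : x ∈ geodesicSegment a b)
    (hy : y ∈ geodesicSegment a b) (h : dist a x = dist a y) : x = y := by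
  obtain ⟨f, f0, f1, hf, hs⟩ := hT.exists_extension a b
  rw [hs] at hx hy
  obtain ⟨u, hu, rfl⟩ := hx
  obtain ⟨v, hv, rfl⟩ := hy
  have e0 := hf 0 u le_rfl hu.1 hu.2
  have e1 := hf 0 v le_rfl hv.1 hv.2
  rw [f0] at e0 e1
  rw [show u = v by linarith]

theorem IsRTree.isCompact_segment (hT : IsRTree T) (a b : T) :
    IsCompact (geodesicSegment a b) := by
  obtain ⟨γ, hγ, -⟩ := hT.existsUnique_arc a b
  have : geodesicSegment a b = Set.range γ := by
    ext x
    constructor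
    · rintro ⟨δ, hδ, v, rfl⟩
      rw [hT.eq_of_arc hδ hγ]
      exact ⟨v, rfl⟩
    · rintro ⟨v, rfl⟩
      exact mem_segment_of_isGeodesicArc hγ _
  rw [this]
  exact isCompact_range hγ.1.continuous

theorem GeodesicRay.dist_eq (ρ : GeodesicRay T) (s t : NNReal) :
    dist (ρ.toFun s) (ρ.toFun t) = |(s : ℝ) - t| := by
  rw [ρ.isometry.dist_eq, NNReal.dist_eq]

theorem GeodesicRay.dist_add (ρ : GeodesicRay T) (s v : NNReal) :
    dist (ρ.toFun s) (ρ.toFun (s + v)) = v := by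
  rw [ρ.dist_eq]; push_cast; rw [sub_add_cancel_left, abs_neg, abs_of_nonneg v.coe_nonneg]

/-- The ray that is left when an initial piece of length `s` is removed. -/
def GeodesicRay.drop (ρ : GeodesicRay T) (s : NNReal) : GeodesicRay T where
  toFun v := ρ.toFun (s + v)
  isometry := Isometry.of_dist_eq fun u v => by
    rw [ρ.dist_eq, NNReal.dist_eq]; push_cast; rw [add_sub_add_left_eq_sub]

theorem GeodesicRay.drop_equiv (ρ : GeodesicRay T) (s : NNReal) :
    (Quotient.mk _ (ρ.drop s) : TreeEnd T) = Quotient.mk _ ρ :=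
  Quotient.sound ⟨0, s, fun v => by rw [zero_add]; rfl⟩

/-- The two rays reach a common subray at the same distance from their common end point; up to there
they agree because arcs are unique. -/
theorem IsRTree.ray_eq (hT : IsRTree T) {ρ σ : GeodesicRay T}
    (h : (Quotient.mk _ ρ : TreeEnd T) = Quotient.mk _ σ) (h0 : ρ.toFun 0 = σ.toFun 0) : ρ = σ := by
  obtain ⟨s, t, hst⟩ := Quotient.exact h
  have hs : s = t := by
    have h1 := ρ.dist_add 0 s
    have h2 := σ.dist_add 0 t
    have h3 := hst 0
    rw [add_zero, add_zero] at h3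
    rw [zero_add, h0, h3] at h1
    rw [zero_add, h1] at h2
    exact NNReal.coe_injective h2
  subst hs
  have key (τ : GeodesicRay T) : ∀ u v : ℝ, 0 ≤ u → u ≤ v → v ≤ s →
      dist (τ.toFun u.toNNReal) (τ.toFun v.toNNReal) = v - u := fun u v hu huv _ => by
    rw [τ.dist_eq, Real.coe_toNNReal _ hu, Real.coe_toNNReal _ (hu.trans huv), abs_sub_comm,
      abs_of_nonneg (sub_nonneg.2 huv)]
  have hon := hT.eqOn_of_dist_eq s.2 (key ρ) (key σ) (by simpa using h0) (by simpa using hst 0)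
  have : ρ.toFun = σ.toFun := by
    funext v
    rcases le_total v s with hv | hv
    · simpa using hon ⟨v.2, NNReal.coe_le_coe.2 hv⟩
    · obtain ⟨w, rfl⟩ := exists_add_of_le hv
      exact hst w
  cases ρ
  cases σ
  congr

/-- Every point of an `ℝ`-tree is the end point of a ray that is equivalent to a given ray. -/
theorem IsRTree.exists_ray_equiv (hT : IsRTree T) (σ : GeodesicRay T) (a : T) :
    ∃ ρ : GeodesicRay T, (Quotient.mk _ ρ : TreeEnd T) = Quotient.mk _ σ ∧ ρ.toFun 0 = a := by
  have hcomp : IsCompact {v : NNReal | σ.toFun v ∈ geodesicSegment a (σ.toFun 0)} :=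
    σ.isometry.isClosedEmbedding.isCompact_preimage (hT.isCompact_segment _ _)
  have hne : {v : NNReal | σ.toFun v ∈ geodesicSegment a (σ.toFun 0)}.Nonempty :=
    ⟨0, hT.mem_segment_iff.2 (by simp)⟩
  -- `σ s` is the last point of `σ` on the segment from `a` to `σ 0`. By maximality, the later part
  -- of `σ` meets the segment from `a` to `σ s` only in `σ s`, so the union axiom makes the
  -- concatenation geodesic.
  obtain ⟨s, hs, hmax⟩ := hcomp.exists_isGreatest hne
  have hsum : ∀ w : NNReal, dist a (σ.toFun (s + w)) = dist a (σ.toFun s) + w := by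
    intro w
    have hint : geodesicSegment a (σ.toFun s) ∩ geodesicSegment (σ.toFun s) (σ.toFun (s + w)) =
        {σ.toFun s} := by
      refine Set.Subset.antisymm ?_ ?_
      · rintro x ⟨hx, hx'⟩
        have h1 := hT.mem_segment_iff.1 hx
        have h2 := hT.mem_segment_iff.1 hx'
        have h3 := hT.mem_segment_iff.1 hs
        rw [σ.dist_add] at h2
        have hxw : dist (σ.toFun s) x ≤ w := by linarith [dist_nonneg (x := x) (y := σ.toFun (s + w))]
        let v : NNReal := ⟨dist (σ.toFun s) x, dist_nonneg⟩
        have hv : v ≤ w := hxw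
        obtain ⟨w', rfl⟩ := exists_add_of_le hv
        have hxv : x = σ.toFun (s + v) := by
          refine hT.eq_of_mem_segment hx' (hT.mem_segment_iff.2 ?_) ?_
          · rw [← add_assoc, σ.dist_add, σ.dist_add, add_assoc, σ.dist_add]
            push_cast; ring
          · rw [σ.dist_add]; rfl
        have hmem : x ∈ geodesicSegment a (σ.toFun 0) := by
          rw [hT.mem_segment_iff]
          refine le_antisymm ?_ (dist_triangle _ _ _)
          have := dist_triangle x (σ.toFun s) (σ.toFun 0)
          linarith
        have hle : s + v ≤ s := hmax (show σ.toFun (s + v) ∈ _ from hxv ▸ hmem)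
        have hv0 : v = 0 := by simpa using hle
        rw [hxv, hv0, add_zero]
        rfl
      · rintro _ rfl
        exact ⟨hT.mem_segment_iff.2 (by simp), hT.mem_segment_iff.2 (by simp)⟩
    have hmem : σ.toFun s ∈ geodesicSegment a (σ.toFun (s + w)) := by
      rw [← hT.union_segment _ _ _ hint]
      exact Or.inl (hT.mem_segment_iff.2 (by simp))
    rw [← hT.mem_segment_iff.1 hmem, σ.dist_add]
  obtain ⟨f, f0, f1, hf, -⟩ := hT.exists_extension a (σ.toFun s)
  let D : NNReal := ⟨dist a (σ.toFun s), dist_nonneg⟩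
  let k : NNReal → T := fun v => if v ≤ D then f v else σ.toFun (s + (v - D))
  have hk : ∀ u v, u ≤ v → dist (k u) (k v) = v - u := by
    intro u v huv
    by_cases hv : v ≤ D
    · simp only [k, if_pos hv, if_pos (huv.trans hv)]
      exact hf u v u.2 huv hv
    obtain ⟨v, rfl⟩ := exists_add_of_le (not_le.1 hv).le
    by_cases hu : u ≤ D
    · simp only [k, if_neg hv, if_pos hu, add_tsub_cancel_left]
      have e0 := hf 0 u le_rfl u.2 hu
      have e1 := hf u D u.2 hu le_rfl
      have e2 := hsum v
      have e3 := σ.dist_add s v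
      have hD : (D : ℝ) = dist a (σ.toFun s) := rfl
      rw [f0] at e0
      rw [hD, f1] at e1
      have t1 := dist_triangle (f u) (σ.toFun s) (σ.toFun (s + v))
      have t2 := dist_triangle a (f u) (σ.toFun (s + v))
      push_cast
      linarith
    · obtain ⟨u, rfl⟩ := exists_add_of_le (not_le.1 hu).le
      have : (u : ℝ) ≤ v := by simpa using huv
      simp only [k, if_neg hv, if_neg hu, add_tsub_cancel_left]
      rw [σ.dist_eq, abs_sub_comm, abs_of_nonneg (by push_cast; linarith)]
      push_cast
      ring
  refine ⟨⟨k, Isometry.of_dist_eq fun u v => ?_⟩, ?_, ?_⟩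
  · rw [NNReal.dist_eq]
    rcases le_total u v with h | h
    · rw [hk u v h, abs_sub_comm, abs_of_nonneg (sub_nonneg.2 (NNReal.coe_le_coe.2 h))]
    · rw [dist_comm, hk v u h, abs_of_nonneg (sub_nonneg.2 (NNReal.coe_le_coe.2 h))]
  · refine Quotient.sound ⟨D, s, fun v => ?_⟩
    change (if D + v ≤ D then f ((D + v : NNReal) : ℝ) else σ.toFun (s + (D + v - D))) = _
    by_cases hv : D + v ≤ D
    · have hv0 : v = 0 := by simpa using hv
      subst hv0
      rw [if_pos hv, add_zero, add_zero]
      exact f1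
    · rw [if_neg hv, add_tsub_cancel_left]
  · change (if (0 : NNReal) ≤ D then f ((0 : NNReal) : ℝ) else _) = a
    rw [if_pos (show (0 : NNReal) ≤ D from D.2)]
    exact f0

end RTree

/-! ### The measured tree attached to an end: 3 implies 4 -/

section EndOrder

variable {T : Type u} [MetricSpace T]

namespace IsRTree

theorem exists_ray (hT : IsRTree T) (e : TreeEnd T) (a : T) :
    ∃ ρ : GeodesicRay T, (Quotient.mk _ ρ : TreeEnd T) = e ∧ ρ.toFun 0 = a := by
  induction e using Quotient.ind with
  | _ σ => exact hT.exists_ray_equiv σ a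

variable (hT : IsRTree T) (e : TreeEnd T)

/-- The geodesic ray with end point `a` that represents the end `e`. -/
noncomputable def rayAt (a : T) : GeodesicRay T := (hT.exists_ray e a).choose

theorem mk_rayAt (a : T) : (Quotient.mk _ (hT.rayAt e a) : TreeEnd T) = e :=
  (hT.exists_ray e a).choose_spec.1

@[simp] theorem rayAt_zero (a : T) : (hT.rayAt e a).toFun 0 = a :=
  (hT.exists_ray e a).choose_spec.2

variable {e}

theorem eq_rayAt {ρ : GeodesicRay T} (h : (Quotient.mk _ ρ : TreeEnd T) = e) :
    ρ = hT.rayAt e (ρ.toFun 0) :=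
  hT.ray_eq (h.trans (hT.mk_rayAt e _).symm) (hT.rayAt_zero e _).symm

variable (e)

/-- A subray represents the same end, so by uniqueness it is the ray attached to its own end point.
-/
theorem rayAt_rayAt (a : T) (v w : NNReal) :
    (hT.rayAt e ((hT.rayAt e a).toFun v)).toFun w = (hT.rayAt e a).toFun (v + w) := by
  have h := hT.eq_rayAt (((hT.rayAt e a).drop_equiv v).trans (hT.mk_rayAt e a))
  have h0 : ((hT.rayAt e a).drop v).toFun 0 = (hT.rayAt e a).toFun v :=
    congrArg (hT.rayAt e a).toFun (add_zero v)
  rw [h0] at h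
  rw [← h]
  rfl

theorem rayAt_injective (a : T) : Function.Injective (hT.rayAt e a).toFun :=
  (hT.rayAt e a).isometry.injective

theorem mem_descendingRay_iff {a x : T} :
    x ∈ descendingRay e a ↔ ∃ v, (hT.rayAt e a).toFun v = x := by
  constructor
  · rintro ⟨ρ, hρ, rfl, v, rfl⟩
    exact ⟨v, by rw [← hT.eq_rayAt hρ]⟩
  · rintro ⟨v, rfl⟩
    exact ⟨_, hT.mk_rayAt e a, hT.rayAt_zero e a, v, rfl⟩

theorem endLE_iff {a x : T} : endLE e x a ↔ ∃ v, (hT.rayAt e a).toFun v = x := by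
  constructor
  · intro h
    exact (hT.mem_descendingRay_iff e).1 (h ((hT.mem_descendingRay_iff e).2 ⟨0, by simp⟩))
  · rintro ⟨v, rfl⟩ y hy
    obtain ⟨w, rfl⟩ := (hT.mem_descendingRay_iff e).1 hy
    exact (hT.mem_descendingRay_iff e).2 ⟨v + w, (hT.rayAt_rayAt e a v w).symm⟩

theorem exists_rayAt_eq_rayAt (a b : T) :
    ∃ s t, (hT.rayAt e a).toFun s = (hT.rayAt e b).toFun t := by
  obtain ⟨s, t, h⟩ := Quotient.exact ((hT.mk_rayAt e a).trans (hT.mk_rayAt e b).symm)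
  exact ⟨s, t, by simpa using h 0⟩

/-- Once two rays to `e` meet they coincide, so passing to a later meeting point increases both
parameters equally. This makes the measure independent of the choice of `c`. -/
theorem sub_eq_sub_of_rayAt_eq {a b : T} {s t s' t' : NNReal}
    (h : (hT.rayAt e a).toFun s = (hT.rayAt e b).toFun t)
    (h' : (hT.rayAt e a).toFun s' = (hT.rayAt e b).toFun t') :
    (s : ℝ) - t = s' - t' := by
  wlog hs : s ≤ s' generalizing s t s' t'
  · exact (this h' h (le_of_not_ge hs)).symm
  obtain ⟨w, rfl⟩ := exists_add_of_le hs
  rw [← hT.rayAt_rayAt, h, hT.rayAt_rayAt] at h'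
  rw [← hT.rayAt_injective e b h']
  push_cast
  ring

theorem endMeasure_eq {b x : T} {s t : NNReal}
    (h : (hT.rayAt e x).toFun s = (hT.rayAt e b).toFun t) : endMeasure e b x = s - t := by
  have hex : ∃ c, endLE e c x ∧ endLE e c b :=
    ⟨_, (hT.endLE_iff e).2 ⟨s, rfl⟩, (hT.endLE_iff e).2 ⟨t, h.symm⟩⟩
  have hc := Classical.epsilon_spec_aux ⟨b⟩ _ hex
  change dist (@Classical.epsilon T ⟨b⟩ (fun c => endLE e c x ∧ endLE e c b)) x -
    dist (@Classical.epsilon T ⟨b⟩ (fun c => endLE e c x ∧ endLE e c b)) b = s - t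
  generalize @Classical.epsilon T ⟨b⟩ (fun c => endLE e c x ∧ endLE e c b) = c at hc ⊢
  obtain ⟨s', rfl⟩ := (hT.endLE_iff e).1 hc.1
  obtain ⟨t', ht'⟩ := (hT.endLE_iff e).1 hc.2
  rw [hT.sub_eq_sub_of_rayAt_eq e h ht'.symm]
  have hs := (hT.rayAt e x).dist_add 0 s'
  have ht := (hT.rayAt e b).dist_add 0 t'
  rw [zero_add, rayAt_zero] at hs ht
  rw [dist_comm, hs, ← ht, ht', dist_comm b]

theorem endMeasure_rayAt (b x : T) (v : NNReal) :
    endMeasure e b ((hT.rayAt e x).toFun v) = endMeasure e b x - v := by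
  obtain ⟨s, t, h⟩ := hT.exists_rayAt_eq_rayAt e x b
  have h' : (hT.rayAt e ((hT.rayAt e x).toFun v)).toFun s = (hT.rayAt e b).toFun (t + v) := by
    rw [rayAt_rayAt, add_comm, ← rayAt_rayAt, h, rayAt_rayAt]
  rw [hT.endMeasure_eq e h, hT.endMeasure_eq e h']
  push_cast
  ring

/-- The order of an `ℝ`-tree that is attached to an end. -/
abbrev endOrder : PartialOrder T where
  le := endLE e
  le_refl _ := Set.Subset.rfl
  le_trans _ _ _ h h' := Set.Subset.trans h h'
  le_antisymm x a h h' := by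
    obtain ⟨v, rfl⟩ := (hT.endLE_iff e).1 h
    obtain ⟨w, hw⟩ := (hT.endLE_iff e).1 h'
    rw [rayAt_rayAt] at hw
    have h0 := hT.rayAt_injective e a (hw.trans (hT.rayAt_zero e a).symm)
    rw [(add_eq_zero.1 h0).1, rayAt_zero]

theorem endLE_or_endLE (hT : IsRTree T) {a x y : T} (hx : endLE e x a) (hy : endLE e y a) :
    endLE e x y ∨ endLE e y x := by
  obtain ⟨v, rfl⟩ := (hT.endLE_iff e).1 hx
  obtain ⟨w, rfl⟩ := (hT.endLE_iff e).1 hy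
  rcases le_total v w with h | h
  · obtain ⟨z, rfl⟩ := exists_add_of_le h
    exact Or.inr ((hT.endLE_iff e).2 ⟨z, hT.rayAt_rayAt e a v z⟩)
  · obtain ⟨z, rfl⟩ := exists_add_of_le h
    exact Or.inl ((hT.endLE_iff e).2 ⟨z, hT.rayAt_rayAt e a w z⟩)

theorem dist_eq_of_endLE (hT : IsRTree T) (b : T) {a x : T} (h : endLE e x a) :
    dist x a = endMeasure e b a - endMeasure e b x := by
  obtain ⟨v, rfl⟩ := (hT.endLE_iff e).1 h
  have := (hT.rayAt e a).dist_add 0 v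
  rw [zero_add, rayAt_zero] at this
  rw [endMeasure_rayAt, dist_comm, this]
  ring

theorem isMeasuredTree_endMeasure (b : T) :
    @IsMeasuredTree T (hT.endOrder e) (endMeasure e b) := by
  let _ := hT.endOrder e
  have hle (x a : T) : x ≤ a ↔ endLE e x a := Iff.rfl
  -- Lower bounds of finite sets are obtained as upper bounds in the dual order, from lower bounds
  -- of pairs.
  have hdir : IsDirectedOrder Tᵒᵈ := ⟨fun x y => by
    obtain ⟨s, t, h⟩ := hT.exists_rayAt_eq_rayAt e (OrderDual.ofDual x) (OrderDual.ofDual y)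
    exact ⟨OrderDual.toDual ((hT.rayAt e (OrderDual.ofDual x)).toFun s),
      (hT.endLE_iff e).2 ⟨s, rfl⟩, (hT.endLE_iff e).2 ⟨t, h.symm⟩⟩⟩
  have hne : Nonempty T := ⟨b⟩
  refine ⟨hne, fun s hs => ?_, fun a x hx y hy _ => hT.endLE_or_endLE e hx hy, ?_, ?_, ?_⟩
  · exact (Set.Finite.bddAbove (α := Tᵒᵈ) hs)
  · intro a x hx y hy hxy
    rcases hT.endLE_or_endLE e hx hy with h | h
    · exact dist_eq_zero.1 (by rw [hT.dist_eq_of_endLE e b h, hxy, sub_self])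
    · exact (dist_eq_zero.1 (by rw [hT.dist_eq_of_endLE e b h, hxy, sub_self])).symm
  · intro a x _ y _ h
    have := hT.dist_eq_of_endLE e b h
    linarith [dist_nonneg (x := x) (y := y)]
  · rintro a ⟨r, hr⟩
    let v : NNReal := (endMeasure e b a - r + 1).toNNReal
    have h1 := hr ⟨(hT.rayAt e a).toFun v, (hT.endLE_iff e).2 ⟨v, rfl⟩, rfl⟩
    rw [endMeasure_rayAt] at h1
    have h2 : endMeasure e b a - r + 1 ≤ v := Real.le_coe_toNNReal _
    linarith

/-- The measure is isometric on a chain. It maps `L` onto `ℝ`, since `L` reaches arbitrarily high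
and the ray below a point takes all smaller values. Its inverse parametrizes the line. -/
theorem isGeodesicLine_of_isMeasuredLine (b : T) {L : Set T}
    (hL : @IsMeasuredLine T (hT.endOrder e) (endMeasure e b) L) : IsGeodesicLine L := by
  let _ := hT.endOrder e
  have hdist : ∀ x ∈ L, ∀ y ∈ L, dist x y = |endMeasure e b x - endMeasure e b y| := by
    intro x hx y hy
    rcases hL.isChain.total hx hy with h | h
    · rw [abs_sub_comm, ← hT.dist_eq_of_endLE e b h, abs_of_nonneg dist_nonneg]
    · rw [← hT.dist_eq_of_endLE e b h, abs_of_nonneg dist_nonneg, dist_comm]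
  have hex : ∀ r : ℝ, ∃ x ∈ L, endMeasure e b x = r := by
    intro r
    obtain ⟨_, ⟨a, ha, rfl⟩, hr⟩ := not_bddAbove_iff.1 hL.not_bddAbove r
    refine ⟨(hT.rayAt e a).toFun (endMeasure e b a - r).toNNReal,
      hL.ray_subset a ha ((hT.endLE_iff e).2 ⟨_, rfl⟩), ?_⟩
    rw [endMeasure_rayAt, Real.coe_toNNReal _ (sub_nonneg.2 hr.le), sub_sub_cancel]
  choose φ hφL hφ using hex
  refine ⟨φ, Isometry.of_dist_eq fun r s => ?_, Set.Subset.antisymm ?_ fun x hx => ?_⟩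
  · rw [hdist _ (hφL r) _ (hφL s), hφ, hφ, Real.dist_eq]
  · rintro _ ⟨r, rfl⟩
    exact hφL r
  · refine ⟨endMeasure e b x, dist_eq_zero.1 ?_⟩
    rw [hdist _ (hφL _) _ hx, hφ, sub_self, abs_zero]

variable {G : Type u} [Group G] [MulAction G T] [IsIsometricSMul G T]

variable {e} in
theorem smul_rayAt (he : FixesEnd G e) (g : G) (a : T) (v : NNReal) :
    g • (hT.rayAt e a).toFun v = (hT.rayAt e (g • a)).toFun v := by
  have h : (Quotient.mk _ ((hT.rayAt e a).translate g) : TreeEnd T) = e := by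
    conv_rhs => rw [← he g, ← hT.mk_rayAt e a]
    rfl
  have h' := hT.eq_rayAt h
  have h0 : ((hT.rayAt e a).translate g).toFun 0 = g • a :=
    congrArg (g • ·) (hT.rayAt_zero e a)
  rw [h0] at h'
  rw [← h']
  rfl

variable {e} in
theorem isMeasuredGTree_endMeasure (he : FixesEnd G e) (b : T) {χ : Character G}
    (h : HasAssociatedCharacter (endMeasure e b) χ) :
    @IsMeasuredGTree T (hT.endOrder e) G _ _ (endMeasure e b) := by
  let _ := hT.endOrder e
  refine ⟨hT.isMeasuredTree_endMeasure e b, fun g => ⟨?_, χ.val g, fun a => ?_⟩⟩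
  · intro x a hxa
    obtain ⟨v, rfl⟩ := (hT.endLE_iff e).1 hxa
    exact (hT.endLE_iff e).2 ⟨v, (hT.smul_rayAt he g a v).symm⟩
  · have := h g a
    linarith

end IsRTree

end EndOrder

/-! ### The four-point criterion for `ℝ`-trees -/

section FourPoint

/-- A geodesic metric space that satisfies the four-point condition is an `ℝ`-tree. -/
theorem isRTree_of_four_point {T : Type u} [MetricSpace T]
    (hgeo : ∀ a b : T, ∃ f : ℝ → T, f 0 = a ∧ f (dist a b) = b ∧
      ∀ u v, 0 ≤ u → u ≤ v → v ≤ dist a b → dist (f u) (f v) = v - u)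
    (hfour : ∀ x y p q : T,
      dist x y + dist p q ≤ max (dist x p + dist y q) (dist x q + dist y p)) : IsRTree T := by
  -- Both sums on the right of the four-point inequality equal `dist a b`, which leaves `dist x y ≤
  -- 0`.
  have uniq : ∀ {a b x y : T}, dist a x + dist x b = dist a b → dist a y + dist y b = dist a b →
      dist a x = dist a y → x = y := by
    intro a b x y hx hy hxy
    have := hfour x y a b
    rw [dist_comm x a, dist_comm y a, max_eq_left (by linarith)] at this
    exact dist_le_zero.1 (by linarith)
  have arc : ∀ a b : T, ∃ γ, IsGeodesicArc a b γ := fun a b => by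
    obtain ⟨f, f0, f1, hf⟩ := hgeo a b
    exact ⟨_, isGeodesicArc_of_dist_eq f0 f1 hf⟩
  have dist_arc : ∀ {a b : T} {γ}, IsGeodesicArc a b γ → ∀ v, dist a (γ v) = v := by
    intro a b γ h v
    have := h.1.dist_eq ⟨0, le_rfl, dist_nonneg⟩ v
    rwa [h.2.1, Subtype.dist_eq, Real.dist_eq, abs_sub_comm, sub_zero, abs_of_nonneg v.2.1] at this
  have mem_iff : ∀ {a b x : T}, x ∈ geodesicSegment a b ↔ dist a x + dist x b = dist a b := by
    intro a b x
    refine ⟨dist_add_dist_of_mem_segment, fun h => ?_⟩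
    obtain ⟨γ, hγ⟩ := arc a b
    have hx : dist a x ≤ dist a b := by linarith [dist_nonneg (x := x) (y := b)]
    refine ⟨γ, hγ, ⟨dist a x, dist_nonneg, hx⟩, ?_⟩
    exact uniq (dist_add_dist_of_mem_segment (mem_segment_of_isGeodesicArc hγ _)) h (dist_arc hγ _)
  have exists_mem : ∀ {a b : T} {v : ℝ}, 0 ≤ v → v ≤ dist a b →
      ∃ x, dist a x = v ∧ dist a x + dist x b = dist a b := by
    intro a b v h0 h1
    obtain ⟨γ, hγ⟩ := arc a b
    exact ⟨γ ⟨v, h0, h1⟩, dist_arc hγ _,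
      dist_add_dist_of_mem_segment (mem_segment_of_isGeodesicArc hγ _)⟩
  refine ⟨fun a b => ?_, fun a b c h => ?_⟩
  · obtain ⟨γ, hγ⟩ := arc a b
    refine ⟨γ, hγ, fun δ hδ => funext fun v => ?_⟩
    refine uniq (dist_add_dist_of_mem_segment (mem_segment_of_isGeodesicArc hδ v))
      (dist_add_dist_of_mem_segment (mem_segment_of_isGeodesicArc hγ v)) ?_
    rw [dist_arc hδ, dist_arc hγ]
  · have habc : dist a b + dist b c = dist a c := by
      have t1 := dist_triangle a b c
      have t2 := dist_triangle b a c
      have t3 := dist_triangle a c b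
      rw [dist_comm b a] at t2
      rw [dist_comm c b] at t3
      -- The distance from `x` to `b` is the Gromov product of `a` and `c` at `b`. The four-point
      -- inequality puts `x` on the segment from `b` to `c` too, so `x = b` and the product
      -- vanishes.
      obtain ⟨x, hx, hx'⟩ := exists_mem (a := a) (b := b)
        (v := dist a b - (dist a b + dist b c - dist a c) / 2) (by linarith) (by linarith)
      have hf := hfour x c a b
      rw [dist_comm x a, dist_comm c b, dist_comm c a, max_eq_left (by linarith)] at hf
      have hxc : x ∈ geodesicSegment b c := by
        refine mem_iff.2 (le_antisymm ?_ (dist_triangle _ _ _))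
        rw [dist_comm b x]
        linarith
      have hxb : x ∈ ({b} : Set T) := h ▸ ⟨mem_iff.2 hx', hxc⟩
      rw [hxb] at hx
      linarith
    ext x
    rw [Set.mem_union, mem_iff, mem_iff, mem_iff]
    have tx := dist_triangle a x c
    constructor
    · rintro (hx | hx)
      · have := dist_triangle x b c
        linarith
      · have := dist_triangle a b x
        linarith
    · intro hx
      rcases le_total (dist a x) (dist a b) with hle | hle
      · obtain ⟨y, hy, hy'⟩ := exists_mem dist_nonneg hle
        have hyc : dist a y + dist y c = dist a c := by
          have := dist_triangle y b c
          have := dist_triangle a y c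
          linarith
        rw [uniq hx hyc hy.symm]
        exact Or.inl hy'
      · obtain ⟨y, hy, hy'⟩ := exists_mem (a := b) (b := c) (v := dist a x - dist a b)
          (by linarith) (by linarith [dist_nonneg (x := x) (y := c)])
        have hyc : dist a y = dist a x ∧ dist a y + dist y c = dist a c := by
          have := dist_triangle a b y
          have := dist_triangle a y c
          constructor <;> linarith
        rw [uniq hx hyc.2 hyc.1.symm]
        exact Or.inr hy'

end FourPoint

/-! ### The `ℝ`-tree of an ultrametric kernel -/

/-- A symmetric ultrametric kernel: `meet a b` is the level down to which one has to descend in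
order to get from `a` to `b`. -/
structure TreeKernel (A : Type u) where
  meet : A → A → ℝ
  symm : ∀ a b, meet a b = meet b a
  ultra : ∀ a b c, min (meet a b) (meet b c) ≤ meet a c

namespace TreeKernel

variable {A : Type u} (K : TreeKernel A)

/-- The points on the rays descending from the elements of `A`. -/
@[ext] structure Point where
  base : A
  level : ℝ
  le : level ≤ K.meet base base

variable {K}

namespace Point

/-- The level at which the rays descending from two points merge. -/
def meet (p q : K.Point) : ℝ := min (min p.level q.level) (K.meet p.base q.base)

theorem meet_comm (p q : K.Point) : meet p q = meet q p := by
  rw [meet, meet, min_comm p.level, K.symm]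

theorem meet_self (p : K.Point) : meet p p = p.level := by
  rw [meet, min_self, min_eq_left p.le]

theorem meet_le_left (p q : K.Point) : meet p q ≤ p.level :=
  (min_le_left _ _).trans (min_le_left _ _)

theorem meet_le_right (p q : K.Point) : meet p q ≤ q.level :=
  (min_le_left _ _).trans (min_le_right _ _)

theorem meet_le_kernel (p q : K.Point) : meet p q ≤ K.meet p.base q.base := min_le_right _ _

theorem meet_ultra (p q r : K.Point) : min (meet p q) (meet q r) ≤ meet p r :=
  le_min (le_min ((min_le_left _ _).trans (meet_le_left _ _))
    ((min_le_right _ _).trans (meet_le_right _ _)))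
    ((min_le_min (meet_le_kernel _ _) (meet_le_kernel _ _)).trans (K.ultra _ _ _))

/-- The length of the path descending from `p` to the merging level and climbing to `q`. Rays with
different bases are at distance zero below their merging level, so this is only a pseudometric. -/
noncomputable instance : PseudoMetricSpace K.Point where
  dist p q := p.level + q.level - 2 * meet p q
  dist_self p := by rw [meet_self]; ring
  dist_comm p q := by rw [meet_comm, add_comm]
  dist_triangle p q r := by
    rcases min_le_iff.1 (meet_ultra p q r) with h | h
    · linarith [meet_le_left q r]
    · linarith [meet_le_right p q]

theorem dist_def (p q : K.Point) : dist p q = p.level + q.level - 2 * meet p q := rfl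

/-- The levels cancel, leaving a statement about sums of meets that follows from four instances of
the ultrametric inequality. -/
theorem four_point (x y p q : K.Point) :
    dist x y + dist p q ≤ max (dist x p + dist y q) (dist x q + dist y p) := by
  by_contra! h
  obtain ⟨h1, h2⟩ := max_lt_iff.1 h
  simp only [dist_def] at h1 h2
  have e1 := meet_ultra x p y
  have e2 := meet_ultra x q y
  have e3 := meet_ultra p x q
  have e4 := meet_ultra p y q
  rw [meet_comm p y] at e1 e4
  rw [meet_comm q y] at e2
  rw [meet_comm p x] at e3
  rw [min_le_iff] at e1 e2 e3 e4
  rcases e1 with e1 | e1 <;> rcases e2 with e2 | e2 <;> rcases e3 with e3 | e3 <;>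
    rcases e4 with e4 | e4 <;> linarith

/-- The point at distance `v` below `p`. -/
def down (p : K.Point) (v : NNReal) : K.Point :=
  ⟨p.base, p.level - v, (sub_le_self _ v.2).trans p.le⟩

theorem meet_down_down (p q : K.Point) (u v : NNReal) :
    meet (p.down u) (q.down v) = min (meet p q) (min (p.level - u) (q.level - v)) := by
  have hu := u.coe_nonneg
  have hv := v.coe_nonneg
  refine le_antisymm (le_min (le_min (le_min ?_ ?_) (meet_le_kernel _ _))
    (le_min (meet_le_left _ _) (meet_le_right _ _)))
    (le_min (min_le_right _ _) ((min_le_left _ _).trans (meet_le_kernel _ _)))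
  · exact (meet_le_left _ _).trans (sub_le_self _ u.2)
  · exact (meet_le_right _ _).trans (sub_le_self _ v.2)

theorem dist_down_down_self (p : K.Point) (u v : NNReal) :
    dist (p.down u) (p.down v) = |(u : ℝ) - v| := by
  rw [dist_def, meet_down_down, meet_self, min_eq_right
    ((min_le_left (p.level - u : ℝ) (p.level - v)).trans (sub_le_self p.level u.2))]
  change p.level - u + (p.level - v) - 2 * _ = _
  rcases le_total (u : ℝ) v with h | h
  · rw [min_eq_right (by linarith), abs_sub_comm, abs_of_nonneg (by linarith)]
    ring
  · rw [min_eq_left (by linarith), abs_of_nonneg (by linarith)]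
    ring

theorem exists_geodesic (p q : K.Point) : ∃ f : ℝ → K.Point, dist (f 0) p = 0 ∧
    dist (f (dist p q)) q = 0 ∧
      ∀ u v, 0 ≤ u → u ≤ v → v ≤ dist p q → dist (f u) (f v) = v - u := by
  have hd := dist_def p q
  have hp := meet_le_left p q
  have hq := meet_le_right p q
  have p0 : p.down 0 = p := by ext <;> simp [down]
  have q0 : q.down 0 = q := by ext <;> simp [down]
  let f : ℝ → K.Point := fun v =>
    if v ≤ p.level - meet p q then p.down v.toNNReal else q.down (dist p q - v).toNNReal
  have hf : ∀ u v, 0 ≤ u → u ≤ v → v ≤ dist p q → dist (f u) (f v) = v - u := by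
    intro u v hu huv hv
    by_cases hv' : v ≤ p.level - meet p q
    · simp only [f, if_pos hv', if_pos (huv.trans hv')]
      rw [dist_down_down_self, Real.coe_toNNReal _ hu, Real.coe_toNNReal _ (hu.trans huv),
        abs_sub_comm, abs_of_nonneg (by linarith)]
    by_cases hu' : u ≤ p.level - meet p q
    · simp only [f, if_neg hv', if_pos hu']
      rw [dist_def, meet_down_down]
      change p.level - u.toNNReal + (q.level - (dist p q - v).toNNReal) - 2 * _ = _
      rw [Real.coe_toNNReal _ hu, Real.coe_toNNReal _ (by linarith), min_eq_left]
      · rw [hd]; ring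
      · exact le_min (by linarith) (by linarith)
    · simp only [f, if_neg hv', if_neg hu']
      rw [dist_down_down_self, Real.coe_toNNReal _ (by linarith), Real.coe_toNNReal _ (by linarith),
        abs_of_nonneg (by linarith)]
      ring
  refine ⟨f, ?_, ?_, hf⟩
  · simp only [f, if_pos (show (0 : ℝ) ≤ p.level - meet p q by linarith), Real.toNNReal_zero, p0,
      dist_self]
  · by_cases h : dist p q ≤ p.level - meet p q
    · simp only [f, if_pos h]
      -- Here `q` has the merging level: the path only descends and ends on the ray of `p`, at
      -- distance zero from `q` but possibly over another base.
      have h' : dist p q = p.level - meet p q := by linarith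
      have hpq : meet p q = q.level := by linarith
      nth_rw 2 [← q0]
      rw [dist_def, meet_down_down, h']
      change p.level - (p.level - meet p q).toNNReal + (q.level - (0 : NNReal)) - 2 * _ = _
      rw [Real.coe_toNNReal _ (by linarith), hpq]
      simp
      ring
    · simp only [f, if_neg h, sub_self, Real.toNNReal_zero, q0, dist_self]

end Point

variable (K) in
/-- The `ℝ`-tree attached to an ultrametric kernel. -/
abbrev Tree : Type u := SeparationQuotient K.Point

variable (K) in
theorem isRTree : IsRTree K.Tree := by
  refine isRTree_of_four_point (fun a b => ?_) (fun x y p q => ?_)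
  · obtain ⟨p, rfl⟩ := SeparationQuotient.surjective_mk a
    obtain ⟨q, rfl⟩ := SeparationQuotient.surjective_mk b
    obtain ⟨f, f0, f1, hf⟩ := p.exists_geodesic q
    refine ⟨fun v => SeparationQuotient.mk (f v), ?_, ?_, hf⟩
    · exact dist_eq_zero.1 f0
    · exact dist_eq_zero.1 f1
  · obtain ⟨x, rfl⟩ := SeparationQuotient.surjective_mk x
    obtain ⟨y, rfl⟩ := SeparationQuotient.surjective_mk y
    obtain ⟨p, rfl⟩ := SeparationQuotient.surjective_mk p
    obtain ⟨q, rfl⟩ := SeparationQuotient.surjective_mk q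
    exact Point.four_point x y p q

namespace Point

/-- The ray descending from a point. -/
noncomputable def ray (p : K.Point) : GeodesicRay K.Tree where
  toFun v := SeparationQuotient.mk (p.down v)
  isometry := Isometry.of_dist_eq fun u v => by
    rw [SeparationQuotient.dist_mk, dist_down_down_self, NNReal.dist_eq]

theorem ray_zero (p : K.Point) : p.ray.toFun 0 = SeparationQuotient.mk p := by
  change SeparationQuotient.mk (p.down 0) = _
  congr 1
  ext <;> simp [down]

/-- The parameters are the heights of `p` and `q` above their merging level. Hence all descending
rays define one end, and its measure is the level up to a constant. -/
theorem exists_ray_add_eq (p q : K.Point) : ∃ s t : NNReal, (s : ℝ) - t = p.level - q.level ∧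
    ∀ v, p.ray.toFun (s + v) = q.ray.toFun (t + v) := by
  refine ⟨⟨p.level - meet p q, sub_nonneg.2 (meet_le_left p q)⟩,
    ⟨q.level - meet p q, sub_nonneg.2 (meet_le_right p q)⟩, ?_, fun v => ?_⟩
  · exact sub_sub_sub_cancel_right _ _ _
  · refine dist_eq_zero.1 ?_
    change dist (p.down _) (q.down _) = 0
    rw [dist_def, meet_down_down]
    change p.level - (p.level - meet p q + v) + (q.level - (q.level - meet p q + v)) -
      2 * min _ (min (p.level - (p.level - meet p q + v)) (q.level - (q.level - meet p q + v))) = 0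
    have hv := v.coe_nonneg
    rw [show p.level - (p.level - meet p q + v) = meet p q - v by ring,
      show q.level - (q.level - meet p q + v) = meet p q - v by ring, min_self,
      min_eq_right (by linarith)]
    ring

theorem mk_ray_eq (p q : K.Point) :
    (Quotient.mk _ p.ray : TreeEnd K.Tree) = Quotient.mk _ q.ray := by
  obtain ⟨s, t, -, h⟩ := exists_ray_add_eq p q
  exact Quotient.sound ⟨s, t, h⟩

theorem endMeasure_mk (o b x : K.Point) :
    endMeasure (Quotient.mk _ o.ray : TreeEnd K.Tree) (SeparationQuotient.mk b)
      (SeparationQuotient.mk x) = x.level - b.level := by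
  obtain ⟨s, t, hst, h⟩ := exists_ray_add_eq x b
  have hx := K.isRTree.eq_rayAt (mk_ray_eq x o)
  have hb := K.isRTree.eq_rayAt (mk_ray_eq b o)
  rw [ray_zero] at hx hb
  have := h 0
  rw [add_zero, add_zero, hx, hb] at this
  rw [K.isRTree.endMeasure_eq _ this, hst]

/-- Two points of a geodesic line that contains points of arbitrarily low level are comparable. -/
theorem meet_eq_of_mem_line {L : Set K.Tree} (hL : IsGeodesicLine L)
    (hlow : ∀ r : ℝ, ∃ w : K.Point, w.level < r ∧ SeparationQuotient.mk w ∈ L) {p q : K.Point}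
    (hp : SeparationQuotient.mk p ∈ L) (hq : SeparationQuotient.mk q ∈ L)
    (hpq : p.level ≤ q.level) : meet p q = p.level := by
  refine le_antisymm (meet_le_left p q) ?_
  obtain ⟨w, hw, hwL⟩ := hlow (meet p q)
  obtain ⟨φ, hφ, rfl⟩ := hL
  obtain ⟨a, ha⟩ := hp
  obtain ⟨b, hb⟩ := hq
  obtain ⟨c, hc⟩ := hwL
  have hab : dist p q = |a - b| := by
    rw [← SeparationQuotient.dist_mk, ← ha, ← hb, hφ.dist_eq, Real.dist_eq]
  have hac : dist p w = |a - c| := by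
    rw [← SeparationQuotient.dist_mk, ← ha, ← hc, hφ.dist_eq, Real.dist_eq]
  have hbc : dist q w = |b - c| := by
    rw [← SeparationQuotient.dist_mk, ← hb, ← hc, hφ.dist_eq, Real.dist_eq]
  -- One of three points on a line lies between the others. It cannot be `w`, which is below the
  -- merging level of `p` and `q`; in the other two cases one of `p`, `q` lies below the other.
  have between : dist p q = dist p w + dist q w ∨ dist p w = dist p q + dist q w ∨
      dist q w = dist p q + dist p w := by
    rw [hab, hac, hbc]
    grind
  simp only [dist_def] at between
  have h1 := meet_le_right p w
  have h2 := meet_le_right q w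
  have h3 := meet_ultra p q w
  have h4 := meet_ultra q p w
  rw [meet_comm q p] at h4
  rw [min_eq_right (by linarith)] at h3 h4
  rcases between with h | h | h <;> linarith

end Point

end TreeKernel

/-! ### The `ℝ`-tree of a Cayley graph: 4 implies 1 -/

section CayleyKernel

variable {G : Type u} [Group G] {X : Type u} {η : X → G}

/-- The supremum of the levels at which two group elements can be joined. -/
noncomputable def joinLevel (η : X → G) (χ : Character G) (g h : G) : ℝ :=
  sSup {r | Joined η χ r g h}

theorem Joined.le_joinLevel {χ : Character G} {r : ℝ} {g h : G} (H : Joined η χ r g h) :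
    r ≤ joinLevel η χ g h :=
  le_csSup ⟨χ.val g, fun _ H => H.le_left⟩ H

/-- The inequality is strict because the supremum need not be attained. -/
theorem joined_of_lt_joinLevel (hη : IsGeneratingSystem η) {χ : Character G} {r : ℝ} {g h : G}
    (hr : r < joinLevel η χ g h) : Joined η χ r g h := by
  obtain ⟨s, hs, hrs⟩ := exists_lt_of_lt_csSup (Joined.exists_level hη χ g h) hr
  exact Joined.mono hs hrs.le

theorem le_joinLevel_self (η : X → G) (χ : Character G) (g : G) :
    χ.val g ≤ joinLevel η χ g g :=
  (Joined.refl le_rfl).le_joinLevel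

theorem joinLevel_smul_le (hη : IsGeneratingSystem η) (χ : Character G) (k g h : G) :
    χ.val k + joinLevel η χ g h ≤ joinLevel η χ (k * g) (k * h) := by
  refine le_of_forall_lt fun r hr => ?_
  obtain ⟨s, hs, hs'⟩ := exists_between (sub_lt_iff_lt_add'.2 hr)
  exact (sub_lt_iff_lt_add'.1 hs).trans_le ((joined_of_lt_joinLevel hη hs').smul k).le_joinLevel

theorem joinLevel_smul (hη : IsGeneratingSystem η) (χ : Character G) (k g h : G) :
    joinLevel η χ (k * g) (k * h) = χ.val k + joinLevel η χ g h := by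
  refine le_antisymm ?_ (joinLevel_smul_le hη χ k g h)
  have := joinLevel_smul_le hη χ k⁻¹ (k * g) (k * h)
  rw [inv_mul_cancel_left, inv_mul_cancel_left, Character.val_inv] at this
  linarith

/-- The ultrametric kernel on `G` given by `joinLevel`. -/
noncomputable def cayleyKernel (hη : IsGeneratingSystem η) (χ : Character G) : TreeKernel G where
  meet := joinLevel η χ
  symm g h := congrArg sSup (Set.ext fun _ => ⟨Joined.symm, Joined.symm⟩)
  ultra a b c := le_of_forall_lt fun r hr => by
    obtain ⟨s, hs, hs'⟩ := exists_between hr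
    obtain ⟨h1, h2⟩ := lt_min_iff.1 hs'
    exact hs.trans_le
      ((joined_of_lt_joinLevel hη h1).trans (joined_of_lt_joinLevel hη h2)).le_joinLevel

variable (hη : IsGeneratingSystem η) (χ : Character G)

instance : MulAction G (cayleyKernel hη χ).Point where
  smul g p := ⟨g * p.base, χ.val g + p.level, by
    change _ ≤ joinLevel η χ _ _
    rw [joinLevel_smul hη]
    exact (add_le_add_iff_left _).2 p.le⟩
  one_smul p := TreeKernel.Point.ext (one_mul _)
    (show χ.val 1 + p.level = p.level by rw [Character.val_one, zero_add])
  mul_smul g h p := TreeKernel.Point.ext (mul_assoc _ _ _)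
    (show χ.val (g * h) + p.level = χ.val g + (χ.val h + p.level) by
      rw [Character.val_mul, add_assoc])

variable {hη χ}

theorem level_smul (g : G) (p : (cayleyKernel hη χ).Point) :
    (g • p).level = χ.val g + p.level := rfl

instance : IsIsometricSMul G (cayleyKernel hη χ).Point where
  isometry_smul g := Isometry.of_dist_eq fun p q => by
    have hk : (cayleyKernel hη χ).meet (g • p).base (g • q).base =
        χ.val g + (cayleyKernel hη χ).meet p.base q.base := joinLevel_smul hη χ g _ _
    rw [TreeKernel.Point.dist_def, TreeKernel.Point.dist_def, TreeKernel.Point.meet,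
      TreeKernel.Point.meet, hk, level_smul, level_smul, min_add_add_left, min_add_add_left]
    ring

instance : IsIsometricSMul G (cayleyKernel hη χ).Tree where
  isometry_smul g := Isometry.of_dist_eq fun x y => by
    obtain ⟨p, rfl⟩ := SeparationQuotient.surjective_mk x
    obtain ⟨q, rfl⟩ := SeparationQuotient.surjective_mk y
    exact dist_smul g p q

theorem fixesEnd_cayleyKernel (o : (cayleyKernel hη χ).Point) :
    FixesEnd G (Quotient.mk _ o.ray : TreeEnd (cayleyKernel hη χ).Tree) := by
  intro g
  refine Eq.trans (congrArg (Quotient.mk _) ?_) (TreeKernel.Point.mk_ray_eq (g • o) o)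
  have h : (o.ray.translate g).toFun = (g • o).ray.toFun := by
    funext v
    change SeparationQuotient.mk (g • o.down v) = SeparationQuotient.mk ((g • o).down v)
    congr 1
    ext
    · rfl
    · change χ.val g + (o.level - v) = χ.val g + o.level - v
      ring
  generalize o.ray.translate g = ρ at h
  generalize (g • o).ray = σ at h
  cases ρ
  cases σ
  congr

theorem hasAssociatedCharacter_cayleyKernel (o : (cayleyKernel hη χ).Point)
    (b : (cayleyKernel hη χ).Tree) :
    HasAssociatedCharacter
      (endMeasure (Quotient.mk _ o.ray : TreeEnd (cayleyKernel hη χ).Tree) b) χ := by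
  intro g a
  obtain ⟨p, rfl⟩ := SeparationQuotient.surjective_mk a
  obtain ⟨q, rfl⟩ := SeparationQuotient.surjective_mk b
  rw [← SeparationQuotient.mk_smul, TreeKernel.Point.endMeasure_mk,
    TreeKernel.Point.endMeasure_mk, level_smul]
  ring

theorem exists_letter_val_ne_zero (hη : IsGeneratingSystem η) (hχ : χ ≠ 0) :
    ∃ x, χ.val (η x) ≠ 0 := by
  by_contra! h
  suffices ∀ g : G, χ.val g = 0 from hχ (AddMonoidHom.ext fun g => this g.toMul)
  intro g
  have hg : g ∈ Subgroup.closure (Set.range η) := by rw [hη]; trivial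
  induction hg using Subgroup.closure_induction with
  | mem k hk => obtain ⟨x, rfl⟩ := hk; exact h x
  | one => simp
  | mul a b _ _ iha ihb => rw [Character.val_mul, iha, ihb, add_zero]
  | inv a _ ih => rw [Character.val_inv, ih, neg_zero]

/-- Some letter or its inverse has positive value, and the path through its powers climbs without
ever going below `0`. -/
theorem exists_joined_one (hη : IsGeneratingSystem η) (hχ : χ ≠ 0) (r : ℝ) :
    ∃ t, r < χ.val t ∧ Joined η χ 0 1 t := by
  obtain ⟨s, hs, hJ⟩ : ∃ s, 0 < χ.val s ∧ Joined η χ 0 1 s := by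
    obtain ⟨x, hx⟩ := exists_letter_val_ne_zero hη hχ
    rcases hx.lt_or_gt with hx | hx
    · have hx' : 0 < χ.val (η x)⁻¹ := by rw [Character.val_inv]; linarith
      refine ⟨(η x)⁻¹, hx', Joined.symm ?_⟩
      have := Joined.step (η := η) (x := x) hx'.le (by simp)
      rwa [inv_mul_cancel] at this
    · refine ⟨η x, hx, ?_⟩
      have := Joined.step (η := η) (χ := χ) (r := 0) (g := 1) (x := x) (by simp) (by simpa using hx.le)
      rwa [one_mul] at this
  have hpow : ∀ n : ℕ, Joined η χ 0 1 (s ^ n) := by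
    intro n
    induction n with
    | zero => rw [pow_zero]; exact Joined.refl (by simp)
    | succ n ih =>
      have := hJ.smul (s ^ n)
      rw [mul_one, ← pow_succ] at this
      refine ih.trans (this.mono ?_)
      rw [Character.val_pow, add_zero]
      positivity
  obtain ⟨n, hn⟩ := exists_nat_gt (r / χ.val s)
  exact ⟨s ^ n, by rw [Character.val_pow]; exact (div_lt_iff₀ hs).1 hn, hpow n⟩

/-- If the elements of non-negative value can be joined to `1` at some level, then this is possible
at level `0`. -/
theorem upperGraph_connected_of_joined (hη : IsGeneratingSystem η) (hχ : χ ≠ 0) {r : ℝ}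
    (H : ∀ h, 0 ≤ χ.val h → Joined η χ r 1 h) : (upperGraph η χ 0).Connected := by
  rw [upperGraph_connected_iff]
  intro h hh
  -- The path runs `1 → t → h * t → h`. Its middle piece is the translate by `t` of a path from `1`
  -- to the conjugate `t⁻¹ * h * t`, at level `χ t + r > 0`.
  obtain ⟨t, ht, hJ⟩ := exists_joined_one hη hχ (-r)
  have h1 : Joined η χ 0 h (h * t) := by
    have := hJ.smul h
    rw [mul_one] at this
    exact this.mono (by linarith)
  have h2 : Joined η χ 0 t (h * t) := by
    have := (H (t⁻¹ * (h * t)) (by simpa using hh)).smul t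
    rw [mul_one, mul_inv_cancel_left] at this
    exact this.mono (by linarith)
  exact (hJ.trans h2).trans h1.symm

theorem upperGraph_connected_of_invariant_line (hη : IsGeneratingSystem η) (hχ : χ ≠ 0)
    {L : Set (cayleyKernel hη χ).Tree} (hL : IsGeodesicLine L) (hinv : IsInvariantSet G L) :
    (upperGraph η χ 0).Connected := by
  obtain ⟨p, hp⟩ : ∃ p : (cayleyKernel hη χ).Point, SeparationQuotient.mk p ∈ L := by
    obtain ⟨φ, -, rfl⟩ := hL
    obtain ⟨p, hp⟩ := SeparationQuotient.surjective_mk (φ 0)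
    exact ⟨p, 0, hp.symm⟩
  have hsmul : ∀ g : G, SeparationQuotient.mk (g • p) ∈ L := fun g => by
    rw [← hinv g]
    exact ⟨_, hp, rfl⟩
  have hlow : ∀ r : ℝ, ∃ w : (cayleyKernel hη χ).Point, w.level < r ∧
      SeparationQuotient.mk w ∈ L := by
    intro r
    obtain ⟨g, hg⟩ := Character.exists_lt_val hχ (p.level - r)
    refine ⟨g⁻¹ • p, ?_, hsmul _⟩
    rw [level_smul, Character.val_inv]
    linarith
  -- Comparability of `p` and `k • p` bounds the joining level of their bases below by `p.level`.
  -- Translating the first base to `1` subtracts its value, and the `1` provides strictness.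
  -- Conjugating `h` gives `k * p.base = p.base * h` with `χ k = χ h`.
  refine upperGraph_connected_of_joined hη hχ (r := p.level - χ.val p.base - 1) fun h hh => ?_
  refine joined_of_lt_joinLevel hη ?_
  let k : G := p.base * h * p.base⁻¹
  have hk : p.level ≤ (k • p).level := by
    rw [level_smul, Character.val_mul, Character.val_mul, Character.val_inv]
    linarith
  have h1 := TreeKernel.Point.meet_eq_of_mem_line hL hlow hp (hsmul k) hk
  have h2 : p.level ≤ joinLevel η χ p.base (k * p.base) :=
    h1.ge.trans (TreeKernel.Point.meet_le_kernel _ _)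
  have h3 := joinLevel_smul hη χ p.base 1 h
  rw [mul_one, show p.base * h = k * p.base by simp [k]] at h3
  linarith

end CayleyKernel

end SigmaOne

theorem theoremC2p43 {G : Type u} [Group G] (χ : SigmaOne.Character G) (hχ : χ ≠ 0) :
    List.TFAE [
      rayOfNeZero ℝ χ hχ ∈ SigmaOne.sigmaOne G,
      ∀ (X : Type u) (η : X → G), SigmaOne.IsGeneratingSystem η →
        SigmaOne.IsMeasuredLine (SigmaOne.CayleyTree.lam η χ) Set.univ,
      ∀ (T : Type u) [PartialOrder T] [MulAction G T] (lam : T → ℝ),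
        SigmaOne.IsMeasuredGTree G lam → SigmaOne.HasAssociatedCharacter lam χ →
        ∃ L : Set T, SigmaOne.IsMeasuredLine lam L ∧ SigmaOne.IsInvariantSet G L,
      ∀ (T : Type u) [MetricSpace T] [MulAction G T] [IsIsometricSMul G T],
        SigmaOne.IsRTree T → ∀ e : SigmaOne.TreeEnd T, SigmaOne.FixesEnd G e →
        (∀ b : T, SigmaOne.HasAssociatedCharacter (SigmaOne.endMeasure e b) χ) →
        ∃ L : Set T, SigmaOne.IsGeodesicLine L ∧ SigmaOne.IsInvariantSet G L] := by
  rw [SigmaOne.rayOfNeZero_mem_sigmaOne_iff]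
  tfae_have 1 ↔ 2 := by
    refine forall₃_congr fun X η _ => ?_
    exact (SigmaOne.CayleyTree.isMeasuredLine_univ_iff hχ).symm
  tfae_have 1 → 3 := fun H T _ _ lam h hlam => h.exists_invariant_line hχ H hlam
  tfae_have 3 → 4 := by
    intro H T _ _ _ hT e he hχe
    obtain ⟨σ, -⟩ := Quotient.exists_rep e
    let b := σ.toFun 0
    let _ := hT.endOrder e
    obtain ⟨L, hL, hinv⟩ := H T (SigmaOne.endMeasure e b)
      (hT.isMeasuredGTree_endMeasure he b (hχe b)) (hχe b)
    exact ⟨L, hT.isGeodesicLine_of_isMeasuredLine e b hL, hinv⟩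
  tfae_have 4 → 1 := by
    intro H X η hη
    -- Any point would serve, since all descending rays represent the same end.
    let o : (SigmaOne.cayleyKernel hη χ).Point :=
      ⟨1, χ.val 1, SigmaOne.le_joinLevel_self η χ 1⟩
    obtain ⟨L, hL, hinv⟩ := H _ (SigmaOne.cayleyKernel hη χ).isRTree _
      (SigmaOne.fixesEnd_cayleyKernel o) (SigmaOne.hasAssociatedCharacter_cayleyKernel o)
    exact SigmaOne.upperGraph_connected_of_invariant_line hη hχ hL hinv
  tfae_finish
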